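/- Let $D\in\{2,3\}$, $L_1,\dots,L_D>0$, $\Omega=\prod_{i=1}^D(0,L_i)$. Let $H^m_{\rm per}(\Omega)$ be the space of functions in $L^2(\Omega)$ whose $\Omega$-periodic extension has all weak derivatives up to order $m$ in $L^2(\Omega)$, with $\|\phi\|_{H^2_{\rm per}}^2=\|\phi\|^2+\sum_i\|\partial_i\phi\|^2+\sum_{i,j}\|\partial_i\partial_j\phi\|^2$, where $(\cdot,\cdot)$ and $\|\cdot\|$ are the inner product and norm of $L^2(\Omega)$. For $\varepsilon>0$ and $\eta\in\mathbb R$ with $\eta\ge-\varepsilon^{-2}$, let $$\mathcal F(\phi)=\frac{\varepsilon^{-2}}2\int_\Omega(\phi^3-\phi-\varepsilon^2\Delta\phi)^2\,dx-\eta\int_\Omega\Big\{\tfrac14\phi^4-\tfrac12\phi^2+\tfrac{\varepsilon^2}2|\nabla\phi|^2\Big\}dx$$ be the functionalized Cahn–Hilliard energy. For $A\ge1$ and a time step $s>0$, the semi-discrete convex splitting scheme with mobility $M\equiv1$ and initial datum $\phi_0$ is: $\phi^0=\phi_0$ and, for each $k\ge0$, $\phi^{k+1}\in H^2_{\rm per}(\Omega)$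 satisfies, together with some $\mu\in H^1_{\rm per}(\Omega)$, $$(\phi^{k+1},\nu)+s(\nabla\mu,\nabla\nu)=(\phi^k,\nu)\quad\forall\nu\in H^1_{\rm per}(\Omega),$$ and, for all $\psi\in H^2_{\rm per}(\Omega)$, with $\phi=\phi^{k+1}$, $$\big(3\varepsilon^{-2}\phi^5+4A\phi^3+(\varepsilon^{-2}+\eta)\phi,\psi\big)+\varepsilon^2(\Delta\phi,\Delta\psi)+6(\phi|\nabla\phi|^2,\psi)+6(\phi^2\nabla\phi,\nabla\psi)+4A(|\nabla\phi|^2\nabla\phi,\nabla\psi)-(\mu,\psi)$$ $$=\big((4\varepsilon^{-2}+\eta+4A)(\phi^k)^3,\psi\big)+(2+\eta\varepsilon^2)(\nabla\phi^k,\nabla\psi)+4A(|\nabla\phi^k|^2\nabla\phi^k,\nabla\psi).$$ Then there are a constant $C_0>0$ depending only on $\Omega$, and a constant $C_1>0$ depending only on $\Omega,\varepsilon,\eta$, such that $$\frac{\varepsilon^{-2}}6\|\phi\|_{L^6}^6+C_0\varepsilon^2\|\phi\|_{H^2_{\rm per}}^2\le\mathcal F(\phi)+C_1\qquad\forall\phi\in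 H^2_{\rm per}(\Omega),$$ and such that for all $A\ge1$, $s>0$, every $\phi_0\in H^2_{\rm per}(\Omega)$, every solution $(\phi^k)_{k\ge0}$ of the scheme with initial datum $\phi_0$ and every positive integer $k$, $$\|\phi^k\|_{H^2_{\rm per}}\le C_6\quad\text{and}\quad\|\phi^k\|_{H^2_{\rm per}}^2\le C_6,\qquad C_6:=\frac{\mathcal F(\phi^0)+C_1}{C_0\varepsilon^2}.$$ In particular the bound is uniform in $k$ and in $s$. -/

import Mathlib

namespace FCH

open MeasureTheory
open scoped ContDiff

noncomputable section

/-- The periodic cell `Ω = (0, L₁) × ⋯ × (0, L_d)`. -/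
def cell {d : ℕ} (L : Fin d → ℝ) : Set (Fin d → ℝ) :=
  Set.univ.pi fun i => Set.Ioo 0 (L i)

/-- Smooth `Ω`-periodic test functions on `ℝ^d`. -/
structure IsTest {d : ℕ} (L : Fin d → ℝ) (ψ : (Fin d → ℝ) → ℝ) : Prop where
  smooth : ContDiff ℝ ∞ ψ
  periodic : ∀ i, Function.Periodic ψ (Pi.single i (L i))

/-- Membership in `L²(Ω) = L²_per(Ω)`; only the values on the cell matter. -/
def MemL2 {d : ℕ} (L : Fin d → ℝ) (u : (Fin d → ℝ) → ℝ) : Prop :=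
  MemLp u 2 (volume.restrict (cell L))

/-- `v` is the `i`-th weak partial derivative of (the `Ω`-periodic extension of) `u`. Testing against
all smooth periodic functions, and not only those supported in the cell, is what encodes
periodicity of `u` across the faces of the cell. -/
def IsWeakPartial {d : ℕ} (L : Fin d → ℝ) (i : Fin d) (u v : (Fin d → ℝ) → ℝ) : Prop :=
  ∀ ψ : (Fin d → ℝ) → ℝ, IsTest L ψ →
    ∫ x in cell L, u x * fderiv ℝ ψ x (Pi.single i 1) = -∫ x in cell L, v x * ψ x

open Classical in
/-- The `i`-th weak partial derivative `∂ᵢu` (unique up to null sets), when it exists in `L²(Ω)`. -/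
def weakPartial {d : ℕ} (L : Fin d → ℝ) (i : Fin d) (u : (Fin d → ℝ) → ℝ) : (Fin d → ℝ) → ℝ :=
  if h : ∃ v, MemL2 L v ∧ IsWeakPartial L i u v then h.choose else 0

/-- Membership in `H¹_per(Ω)`. -/
structure MemH1 {d : ℕ} (L : Fin d → ℝ) (u : (Fin d → ℝ) → ℝ) : Prop where
  memL2 : MemL2 L u
  exists_partial : ∀ i, ∃ v, MemL2 L v ∧ IsWeakPartial L i u v

/-- Membership in `H²_per(Ω)`. -/
structure MemH2 {d : ℕ} (L : Fin d → ℝ) (u : (Fin d → ℝ) → ℝ) : Prop where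
  memH1 : MemH1 L u
  partial_memH1 : ∀ i, MemH1 L (weakPartial L i u)

/-- The `L²(Ω)` inner product `(u, v)`. -/
def ip {d : ℕ} (L : Fin d → ℝ) (u v : (Fin d → ℝ) → ℝ) : ℝ :=
  ∫ x in cell L, u x * v x

/-- The pointwise product `∇u · ∇v`. -/
def gradDot {d : ℕ} (L : Fin d → ℝ) (u v : (Fin d → ℝ) → ℝ) (x : Fin d → ℝ) : ℝ :=
  ∑ i, weakPartial L i u x * weakPartial L i v x

/-- The squared length `|∇u|²`. -/
def gradSq {d : ℕ} (L : Fin d → ℝ) (u : (Fin d → ℝ) → ℝ) (x : Fin d → ℝ) : ℝ :=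
  gradDot L u u x

/-- The Laplacian `Δu = ∑ᵢ ∂ᵢ∂ᵢu`. -/
def lap {d : ℕ} (L : Fin d → ℝ) (u : (Fin d → ℝ) → ℝ) (x : Fin d → ℝ) : ℝ :=
  ∑ i, weakPartial L i (weakPartial L i u) x

/-- The norm of `H²_per(Ω)`. -/
def normH2 {d : ℕ} (L : Fin d → ℝ) (u : (Fin d → ℝ) → ℝ) : ℝ :=
  Real.sqrt ((∫ x in cell L, u x ^ 2)
    + (∑ i, ∫ x in cell L, weakPartial L i u x ^ 2)
    + ∑ i, ∑ j, ∫ x in cell L, weakPartial L j (weakPartial L i u) x ^ 2)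

/-- The Cahn–Hilliard energy `F₀`. -/
def energyCH {d : ℕ} (L : Fin d → ℝ) (ε : ℝ) (u : (Fin d → ℝ) → ℝ) : ℝ :=
  ∫ x in cell L, (1 / 4 * u x ^ 4 - 1 / 2 * u x ^ 2 + ε ^ 2 / 2 * gradSq L u x)

/-- The Cahn–Hilliard chemical potential `μ₀ = u³ - u - ε² Δu`. -/
def chemCH {d : ℕ} (L : Fin d → ℝ) (ε : ℝ) (u : (Fin d → ℝ) → ℝ) (x : Fin d → ℝ) : ℝ :=
  u x ^ 3 - u x - ε ^ 2 * lap L u x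

/-- The functionalized Cahn–Hilliard energy `F = ε⁻²/2 ∫ μ₀² - η F₀`. -/
def energy {d : ℕ} (L : Fin d → ℝ) (ε η : ℝ) (u : (Fin d → ℝ) → ℝ) : ℝ :=
  (ε ^ 2)⁻¹ / 2 * (∫ x in cell L, chemCH L ε u x ^ 2) - η * energyCH L ε u

/-- `⟨δF_c(u), ψ⟩`: the implicit (convex) part of the chemical potential in weak form. -/
def varFc {d : ℕ} (L : Fin d → ℝ) (ε η A : ℝ) (u ψ : (Fin d → ℝ) → ℝ) : ℝ :=
  ip L (fun x => 3 * (ε ^ 2)⁻¹ * u x ^ 5 + 4 * A * u x ^ 3 + ((ε ^ 2)⁻¹ + η) * u x) ψ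
    + ε ^ 2 * ip L (lap L u) (lap L ψ)
    + 6 * ip L (fun x => u x * gradSq L u x) ψ
    + 6 * (∫ x in cell L, u x ^ 2 * gradDot L u ψ x)
    + 4 * A * (∫ x in cell L, gradSq L u x * gradDot L u ψ x)

/-- `⟨δF_e(u), ψ⟩`: the explicit part of the chemical potential in weak form, that is, the pairing
of `(4ε⁻² + η) u³ - (2 + ηε²) Δu + 4A u³ - 4A ∇·(|∇u|² ∇u)` with `ψ`. -/
def varFe {d : ℕ} (L : Fin d → ℝ) (ε η A : ℝ) (u ψ : (Fin d → ℝ) → ℝ) : ℝ :=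
  ip L (fun x => (4 * (ε ^ 2)⁻¹ + η) * u x ^ 3 + 4 * A * u x ^ 3) ψ
    + (2 + η * ε ^ 2) * (∫ x in cell L, gradDot L u ψ x)
    + 4 * A * (∫ x in cell L, gradSq L u x * gradDot L u ψ x)

/-- One step `u ↦ w` of the convex splitting scheme with time step `s` and mobility `M ≡ 1`, in weak
form: `w ∈ H²_per`, and for some `μ ∈ H¹_per`, `w - u = s Δμ` and `μ = δF_c(w) - δF_e(u)`. -/
structure IsStep {d : ℕ} (L : Fin d → ℝ) (ε η A s : ℝ) (u w : (Fin d → ℝ) → ℝ) : Prop where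
  memH2 : MemH2 L w
  exists_potential : ∃ μ : (Fin d → ℝ) → ℝ, MemH1 L μ ∧
    (∀ ν, MemH1 L ν → ip L w ν + s * (∫ x in cell L, gradDot L μ ν x) = ip L u ν) ∧
    (∀ ψ, MemH2 L ψ → varFc L ε η A w ψ - ip L μ ψ = varFe L ε η A u ψ)

/-- `φ⁰, φ¹, φ², …` is a solution of the scheme with initial datum `φ₀`. -/
structure IsSchemeSolution {d : ℕ} (L : Fin d → ℝ) (ε η A s : ℝ) (φ₀ : (Fin d → ℝ) → ℝ)
    (φ : ℕ → (Fin d → ℝ) → ℝ) : Prop where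
  init : φ 0 = φ₀
  step : ∀ k, IsStep L ε η A s (φ k) (φ (k + 1))

end

end FCH

/-!
Both bounds rest on the expanded form of the energy. Integrating by parts, `∫ u Δu = -∫ |∇u|²` and
`∫ u³ Δu = -3 ∫ u² |∇u|²`, so that `F(u) = ∫ e(u, |∇u|², Δu)` for the polynomial `e` of
`energyDensity` (`MemH2.energy_eq`).

*Coercivity.* On the torus `‖Δu‖² = ∑ᵢⱼ ‖∂ⱼ∂ᵢu‖²`, and `‖∇u‖² = -∫ u Δu`. Hence the difference of
the two sides is the integral of a function of `u` and `Δu` plus the nonnegative term `3u²|∇u|²`,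
and that function is bounded below because `u⁶` dominates the lower powers of `u`
(`exists_energy_lower_bound`). The constant `C₀ = 1/4` works.

*Energy stability.* With the chemical potential `μ` as test function in the first equation and
`w - u` in the second one, a step from `u` to `w` gives `⟨δF_c(w) - δF_e(u), w - u⟩ = -s ‖∇μ‖² ≤ 0`.
Since `F = F_c - F_e` with `F_c` and `F_e` convex, the left side is at least `F(w) - F(u)`.
Convexity holds pointwise, and its only delicate part is that of `a⁴ + |p|⁴ + 3a²|p|²`
(`tangent_quartic`); the condition `A ≥ 1` reduces `F_c` to this case. The condition `η ≥ -ε⁻²`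
makes the remaining coefficients nonnegative.

*Regularity.* All of this presupposes that the integrals converge and that products of Sobolev
functions may be integrated by parts. The tool is the partial Fourier sum `fourierSum`, an
admissible test function that commutes with weak derivatives and converges in `L²`; the
completeness of the Fourier basis is transported from the unit torus. In dimension at most three
the Fourier series of an `H²` function converges absolutely, so that its partial sums are
uniformly bounded. The Gagliardo–Nirenberg inequality `‖∂ᵢf‖₄² ≤ 3 ‖f‖_∞ ‖∂ᵢ∂ᵢf‖₂` for smooth
periodic `f` then puts `∇u` in `L⁴`, and the identity for `u³ Δu` follows by testing with cubes of
partial Fourier sums.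
-/

namespace FCH

open MeasureTheory Filter Topology
open scoped ContDiff ENNReal

noncomputable section

/-! ### Fourier series on the cell -/

/-- The normalization used by Mathlib for Fourier series on the torus, where this instance is
local. -/
local instance torusMeasureSpace : MeasureSpace UnitAddCircle := ⟨AddCircle.haarAddCircle⟩

/-- The section of the quotient map `ℝ^d → ℝ^d / (L₁ℤ × ⋯ × L_dℤ)`, rescaled to the unit torus, that
takes values in `(0, L₁] × ⋯ × (0, L_d]`. -/
def torusSection {d : ℕ} (L : Fin d → ℝ) (t : UnitAddTorus (Fin d)) : Fin d → ℝ :=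
  fun i => L i * (AddCircle.equivIoc 1 0 (t i) : ℝ)

/-- Normalized Lebesgue measure on the cell is the image of the Haar measure of the torus. -/
lemma measurePreserving_torusSection {d : ℕ} (L : Fin d → ℝ) (hL : ∀ i, 0 < L i) :
    MeasurePreserving (torusSection L) volume
      (ENNReal.ofReal (∏ i, L i)⁻¹ • volume.restrict (cell L)) := by
  set S : Set (Fin d → ℝ) := {x | ∀ i, x i ∈ Set.Ioc (0 : ℝ) (0 + 1)} with hS
  have hSm : MeasurableSet S := MeasurableSet.univ_pi' fun i => measurableSet_Ioc
  have h1 : MeasurePreserving (UnitAddTorus.measurableEquivPiIoc (fun _ : Fin d => (0 : ℝ))) volume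
      (Measure.comap Subtype.val volume) := UnitAddTorus.measurePreserving_equivPiIoc _
  have h2 : MeasurePreserving (Subtype.val : S → Fin d → ℝ) (Measure.comap Subtype.val volume)
      (volume.restrict S) := ⟨measurable_subtype_coe, map_comap_subtype_coe hSm _⟩
  set D : (Fin d → ℝ) → Fin d → ℝ := fun x i => L i * x i with hD
  have hDm : Measurable D := by fun_prop
  have hmap : Measure.map D volume = ENNReal.ofReal (∏ i, L i)⁻¹ • volume := by
    have hdet : (Matrix.toLin' (Matrix.diagonal L)).det ≠ 0 := by
      rw [LinearMap.det_toLin', Matrix.det_diagonal]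
      exact Finset.prod_ne_zero_iff.2 fun i _ => (hL i).ne'
    have := Real.map_linearMap_volume_pi_eq_smul_volume_pi hdet
    rw [LinearMap.det_toLin', Matrix.det_diagonal, abs_of_nonneg] at this
    · rw [← this]
      congr 1
      ext x i
      simp [hD, Matrix.mulVec_diagonal]
    · exact inv_nonneg.2 (Finset.prod_nonneg fun i _ => (hL i).le)
  set S' : Set (Fin d → ℝ) := Set.univ.pi fun i => Set.Ioc 0 (L i) with hS'
  have hS'm : MeasurableSet S' := MeasurableSet.univ_pi fun i => measurableSet_Ioc
  have hpre : D ⁻¹' S' = S := by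
    ext x
    simp only [hS', hS, hD, Set.mem_preimage, Set.mem_pi, Set.mem_univ, true_imp_iff, Set.mem_Ioc,
      zero_add, Set.mem_ofPred_eq]
    refine forall_congr' fun i => and_congr ?_ ?_
    · exact mul_pos_iff_of_pos_left (hL i)
    · exact mul_le_iff_le_one_right (hL i)
  have h3 : MeasurePreserving D (volume.restrict S)
      (ENNReal.ofReal (∏ i, L i)⁻¹ • volume.restrict (cell L)) := by
    refine ⟨hDm, ?_⟩
    rw [← hpre, ← Measure.restrict_map hDm hS'm, hmap, Measure.restrict_smul]
    congr 1
    exact Measure.restrict_congr_set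
      (Measure.univ_pi_Ioc_ae_eq_Icc.trans Measure.univ_pi_Ioo_ae_eq_Icc.symm)
  exact h3.comp (h2.comp h1)

/-- The phase `2π (k₁x₁/L₁ + ⋯ + k_dx_d/L_d)` of the `k`-th Fourier mode of the cell. -/
def phase {d : ℕ} (L : Fin d → ℝ) (k : Fin d → ℤ) (x : Fin d → ℝ) : ℝ :=
  ∑ i, 2 * Real.pi * k i / L i * x i

/-- The cosine Fourier coefficient `|Ω|⁻¹ ∫ u cos θ_k`. The modes `k` and `-k` are counted
separately, so that there is no factor `2`. -/
def cosCoeff {d : ℕ} (L : Fin d → ℝ) (u : (Fin d → ℝ) → ℝ) (k : Fin d → ℤ) : ℝ :=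
  (∏ i, L i)⁻¹ * ∫ x in cell L, u x * Real.cos (phase L k x)

/-- The sine Fourier coefficient `|Ω|⁻¹ ∫ u sin θ_k`. -/
def sinCoeff {d : ℕ} (L : Fin d → ℝ) (u : (Fin d → ℝ) → ℝ) (k : Fin d → ℤ) : ℝ :=
  (∏ i, L i)⁻¹ * ∫ x in cell L, u x * Real.sin (phase L k x)

/-- The part of the Fourier series of `u` with modes in the finite set `F`. -/
def fourierSum {d : ℕ} (L : Fin d → ℝ) (F : Finset (Fin d → ℤ)) (u : (Fin d → ℝ) → ℝ)
    (x : Fin d → ℝ) : ℝ :=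
  ∑ k ∈ F, (cosCoeff L u k * Real.cos (phase L k x) + sinCoeff L u k * Real.sin (phase L k x))

lemma mFourier_eq_exp_phase {d : ℕ} (L : Fin d → ℝ) (hL : ∀ i, 0 < L i) (k : Fin d → ℤ)
    (t : UnitAddTorus (Fin d)) :
    UnitAddTorus.mFourier k t = Complex.exp (phase L k (torusSection L t) * Complex.I) := by
  simp only [UnitAddTorus.mFourier, ContinuousMap.coe_mk, phase, torusSection]
  push_cast
  rw [Finset.sum_mul, Complex.exp_sum]
  refine Finset.prod_congr rfl fun i _ => ?_
  have h : t i = ((AddCircle.equivIoc 1 0 (t i) : ℝ) : AddCircle (1 : ℝ)) :=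
    ((AddCircle.equivIoc 1 0).symm_apply_apply (t i)).symm
  conv_lhs => rw [h]
  rw [fourier_coe_apply]
  congr 1
  have : (L i : ℂ) ≠ 0 := by exact_mod_cast (hL i).ne'
  push_cast
  field_simp

lemma continuous_phase {d : ℕ} (L : Fin d → ℝ) (k : Fin d → ℤ) : Continuous (phase L k) := by
  unfold phase; fun_prop

instance isFiniteMeasure_restrict_cell {d : ℕ} (L : Fin d → ℝ) :
    IsFiniteMeasure (volume.restrict (cell L)) := by
  refine ⟨?_⟩
  rw [Measure.restrict_apply_univ, cell, Real.volume_pi_Ioo]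
  exact ENNReal.prod_lt_top fun i _ => ENNReal.ofReal_lt_top

lemma MemL2.integrable {d : ℕ} {L : Fin d → ℝ} {u : (Fin d → ℝ) → ℝ} (hu : MemL2 L u) :
    Integrable u (volume.restrict (cell L)) :=
  MemLp.integrable one_le_two hu

lemma MemL2.comp_torusSection {d : ℕ} {L : Fin d → ℝ} (hL : ∀ i, 0 < L i)
    {u : (Fin d → ℝ) → ℝ} (hu : MemL2 L u) :
    MemLp (fun t => (u (torusSection L t) : ℂ)) 2 volume :=
  ((hu.smul_measure ENNReal.ofReal_ne_top).comp_measurePreserving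
    (measurePreserving_torusSection L hL)).ofReal

lemma integral_comp_torusSection {d : ℕ} (L : Fin d → ℝ) (hL : ∀ i, 0 < L i)
    {E : Type*} [NormedAddCommGroup E] [NormedSpace ℝ E] {g : (Fin d → ℝ) → E}
    (hg : AEStronglyMeasurable g (volume.restrict (cell L))) :
    ∫ t, g (torusSection L t) = (∏ i, L i)⁻¹ • ∫ x in cell L, g x := by
  have hmp := measurePreserving_torusSection L hL
  have hg' : AEStronglyMeasurable g (Measure.map (torusSection L) volume) := by
    rw [hmp.map_eq]; exact hg.smul_measure _
  rw [← integral_map hmp.measurable.aemeasurable hg', hmp.map_eq, integral_smul_measure,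
    ENNReal.toReal_ofReal (inv_nonneg.2 (Finset.prod_nonneg fun i _ => (hL i).le))]

lemma mFourierCoeff_comp_torusSection {d : ℕ} {L : Fin d → ℝ} (hL : ∀ i, 0 < L i)
    {u : (Fin d → ℝ) → ℝ} (hu : MemL2 L u) (k : Fin d → ℤ) :
    UnitAddTorus.mFourierCoeff (fun t => (u (torusSection L t) : ℂ)) k
      = cosCoeff L u k - sinCoeff L u k * Complex.I := by
  have hcos : Integrable (fun x => u x * Real.cos (phase L k x)) (volume.restrict (cell L)) := by
    refine hu.integrable.mul_bdd (c := 1) ?_ (.of_forall fun x => Real.abs_cos_le_one _)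
    exact (Real.continuous_cos.comp (continuous_phase L k)).aestronglyMeasurable
  have hsin : Integrable (fun x => u x * Real.sin (phase L k x)) (volume.restrict (cell L)) := by
    refine hu.integrable.mul_bdd (c := 1) ?_ (.of_forall fun x => Real.abs_sin_le_one _)
    exact (Real.continuous_sin.comp (continuous_phase L k)).aestronglyMeasurable
  have key : ∀ x, Complex.exp (-(phase L k x * Complex.I)) * (u x : ℂ)
      = ((u x * Real.cos (phase L k x) : ℝ) : ℂ)
        - ((u x * Real.sin (phase L k x) : ℝ) : ℂ) * Complex.I := by
    intro x
    rw [← neg_mul, Complex.exp_mul_I, Complex.cos_neg, Complex.sin_neg]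
    push_cast
    ring
  calc UnitAddTorus.mFourierCoeff (fun t => (u (torusSection L t) : ℂ)) k
      = ∫ t, (fun x => Complex.exp (-(phase L k x * Complex.I)) * (u x : ℂ))
          (torusSection L t) := by
        refine integral_congr_ae (.of_forall fun t => ?_)
        simp only [smul_eq_mul]
        rw [mFourier_eq_exp_phase L hL]
        congr 3
        simp [phase, neg_div, Finset.sum_neg_distrib]
    _ = (∏ i, L i)⁻¹ • ∫ x in cell L, (((u x * Real.cos (phase L k x) : ℝ) : ℂ)
        - ((u x * Real.sin (phase L k x) : ℝ) : ℂ) * Complex.I) := by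
        simp only [key]
        exact integral_comp_torusSection L hL
          (hcos.ofReal.sub (hsin.ofReal.mul_const Complex.I)).aestronglyMeasurable
    _ = _ := by
        have hcos' : Integrable (fun x => ((u x * Real.cos (phase L k x) : ℝ) : ℂ))
            (volume.restrict (cell L)) := hcos.ofReal
        have hsin' : Integrable (fun x => ((u x * Real.sin (phase L k x) : ℝ) : ℂ))
            (volume.restrict (cell L)) := hsin.ofReal
        rw [integral_sub hcos' (hsin'.mul_const Complex.I), integral_mul_const,
          integral_complex_ofReal, integral_complex_ofReal, cosCoeff, sinCoeff, Complex.real_smul]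
        push_cast
        ring

/-- Parseval's identity on the cell. -/
theorem hasSum_sq_coeff {d : ℕ} {L : Fin d → ℝ} (hL : ∀ i, 0 < L i)
    {u : (Fin d → ℝ) → ℝ} (hu : MemL2 L u) :
    HasSum (fun k => cosCoeff L u k ^ 2 + sinCoeff L u k ^ 2)
      ((∏ i, L i)⁻¹ * ∫ x in cell L, u x ^ 2) := by
  have hg := hu.comp_torusSection hL
  have h := UnitAddTorus.hasSum_sq_mFourierCoeff (hg.toLp _)
  have h1 : ∀ k, ‖UnitAddTorus.mFourierCoeff (hg.toLp _) k‖ ^ 2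
      = cosCoeff L u k ^ 2 + sinCoeff L u k ^ 2 := by
    intro k
    have : UnitAddTorus.mFourierCoeff (hg.toLp _) k
        = UnitAddTorus.mFourierCoeff (fun t => (u (torusSection L t) : ℂ)) k :=
      integral_congr_ae (ae_eq_rfl.mul hg.coeFn_toLp)
    rw [this, mFourierCoeff_comp_torusSection hL hu, ← Complex.normSq_eq_norm_sq,
      sub_eq_add_neg, ← neg_mul, ← Complex.ofReal_neg, Complex.normSq_add_mul_I]
    ring
  have h2 : ∫ t, ‖(hg.toLp _) t‖ ^ 2 = (∏ i, L i)⁻¹ * ∫ x in cell L, u x ^ 2 := by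
    rw [← smul_eq_mul, ← integral_comp_torusSection L hL (hu.integrable_sq).aestronglyMeasurable]
    refine integral_congr_ae ?_
    filter_upwards [hg.coeFn_toLp] with t ht
    rw [ht, Complex.norm_real, Real.norm_eq_abs, sq_abs]
  simpa only [h1, h2] using h

/-- Fourier series converge in `L²(Ω)`. -/
theorem tendsto_fourierSum {d : ℕ} {L : Fin d → ℝ} (hL : ∀ i, 0 < L i)
    {u : (Fin d → ℝ) → ℝ} (hu : MemL2 L u) :
    Tendsto (fun F => eLpNorm (fourierSum L F u - u) 2 (volume.restrict (cell L))) atTop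
      (𝓝 0) := by
  have hg := hu.comp_torusSection hL
  have hmp := measurePreserving_torusSection L hL
  set c : ℝ≥0∞ := ENNReal.ofReal (∏ i, L i)⁻¹ with hc
  have hcpos : 0 < (∏ i, L i)⁻¹ := inv_pos.2 (Finset.prod_pos fun i _ => hL i)
  have hc0 : c ≠ 0 := by rw [hc, Ne, ENNReal.ofReal_eq_zero, not_le]; exact hcpos
  have hcont : ∀ F, Continuous (fourierSum L F u) := by
    intro F
    have := continuous_phase L
    unfold fourierSum
    fun_prop
  have hcoeff : ∀ k, UnitAddTorus.mFourierCoeff (hg.toLp _) k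
      = cosCoeff L u k - sinCoeff L u k * Complex.I := fun k => by
    rw [← mFourierCoeff_comp_torusSection hL hu]
    exact integral_congr_ae (ae_eq_rfl.mul hg.coeFn_toLp)
  have h := UnitAddTorus.hasSum_mFourier_series_L2 (hg.toLp _)
  rw [HasSum, Lp.tendsto_Lp_iff_tendsto_eLpNorm'] at h
  rw [SummationFilter.unconditional_filter] at h
  -- `fourierSum` is the real part of the complex partial sum, and `|re z| ≤ ‖z‖`.
  have hbound : ∀ F : Finset (Fin d → ℤ),
      eLpNorm (fourierSum L F u - u) 2 (c • volume.restrict (cell L))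
        ≤ eLpNorm (⇑(∑ k ∈ F, UnitAddTorus.mFourierCoeff (hg.toLp _) k
            • UnitAddTorus.mFourierLp 2 k) - ⇑(hg.toLp _)) 2 volume := by
    intro F
    rw [← eLpNorm_comp_measurePreserving
      (((hcont F).aestronglyMeasurable.sub hu.aestronglyMeasurable).smul_measure c) hmp]
    refine eLpNorm_mono_ae ?_
    have hae : ∀ᵐ t : UnitAddTorus (Fin d), ∀ k,
        UnitAddTorus.mFourierLp 2 k t = UnitAddTorus.mFourier k t :=
      ae_all_iff.2 fun k => UnitAddTorus.coeFn_mFourierLp 2 k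
    have hsm : ∀ᵐ t : UnitAddTorus (Fin d), ∀ k,
        (UnitAddTorus.mFourierCoeff (hg.toLp _) k • UnitAddTorus.mFourierLp 2 k
          : Lp ℂ 2 (volume : Measure (UnitAddTorus (Fin d)))) t
        = UnitAddTorus.mFourierCoeff (hg.toLp _) k • UnitAddTorus.mFourierLp 2 k t :=
      ae_all_iff.2 fun k => Lp.coeFn_smul _ _
    filter_upwards [hae, hsm, hg.coeFn_toLp, Lp.coeFn_finsetSum F fun k =>
      UnitAddTorus.mFourierCoeff (hg.toLp _) k • UnitAddTorus.mFourierLp 2 k] with t h1 h2 h3 h4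
    rw [Pi.sub_apply, h4, h3, Finset.sum_apply]
    rw [Finset.sum_congr rfl fun k _ => by
      rw [h2 k, h1 k, hcoeff, mFourier_eq_exp_phase L hL, smul_eq_mul]]
    have hre : (fourierSum L F u - u) (torusSection L t)
        = (∑ k ∈ F, ((cosCoeff L u k : ℂ) - sinCoeff L u k * Complex.I) *
            Complex.exp (phase L k (torusSection L t) * Complex.I)
            - (u (torusSection L t) : ℂ)).re := by
      rw [Complex.sub_re, Complex.re_sum, Complex.ofReal_re, Pi.sub_apply, fourierSum]
      congr 1
      refine Finset.sum_congr rfl fun k _ => ?_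
      simp only [Complex.exp_mul_I, ← Complex.ofReal_cos, ← Complex.ofReal_sin,
        Complex.mul_re, Complex.sub_re, Complex.sub_im, Complex.add_re, Complex.add_im,
        Complex.mul_im, Complex.ofReal_re, Complex.ofReal_im, Complex.I_re, Complex.I_im]
      ring
    rw [Function.comp_apply, hre, Real.norm_eq_abs]
    exact Complex.abs_re_le_norm _
  have h5 := tendsto_of_tendsto_of_tendsto_of_le_of_le tendsto_const_nhds h (fun _ => zero_le)
    hbound
  simp only [eLpNorm_smul_measure_of_ne_zero hc0, smul_eq_mul] at h5
  have hc1 : c ^ (1 / (2 : ℝ≥0∞)).toReal ≠ 0 :=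
    (ENNReal.rpow_pos (pos_iff_ne_zero.2 hc0) ENNReal.ofReal_ne_top).ne'
  have hc2 : c ^ (1 / (2 : ℝ≥0∞)).toReal ≠ ⊤ :=
    ENNReal.rpow_ne_top_of_nonneg ENNReal.toReal_nonneg ENNReal.ofReal_ne_top
  have h6 := ENNReal.Tendsto.const_mul (a := (c ^ (1 / (2 : ℝ≥0∞)).toReal)⁻¹) h5
    (Or.inr (ENNReal.inv_ne_top.2 hc1))
  simpa only [← mul_assoc, ENNReal.inv_mul_cancel hc1 hc2, one_mul, mul_zero] using h6

/-! ### Smooth periodic functions -/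

/-- The classical `i`-th partial derivative. -/
def pderiv {d : ℕ} (i : Fin d) (f : (Fin d → ℝ) → ℝ) (x : Fin d → ℝ) : ℝ :=
  fderiv ℝ f x (Pi.single i 1)

section Test

variable {d : ℕ} {L : Fin d → ℝ} {f g : (Fin d → ℝ) → ℝ}

lemma IsTest.differentiableAt (hf : IsTest L f) (x : Fin d → ℝ) : DifferentiableAt ℝ f x :=
  (hf.smooth.differentiable (by simp)).differentiableAt

lemma IsTest.mul (hf : IsTest L f) (hg : IsTest L g) : IsTest L (f * g) :=
  ⟨hf.smooth.mul hg.smooth, fun i => (hf.periodic i).mul (hg.periodic i)⟩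

lemma IsTest.pow (hf : IsTest L f) (n : ℕ) : IsTest L (fun x => f x ^ n) :=
  ⟨hf.smooth.pow n, fun i x => by rw [hf.periodic i x]⟩

lemma IsTest.pderiv (hf : IsTest L f) (i : Fin d) : IsTest L (pderiv i f) := by
  refine ⟨(hf.smooth.fderiv_right (m := ∞) (by simp)).clm_apply contDiff_const, fun j x => ?_⟩
  have h : (fun y => f (y + Pi.single j (L j))) = f := funext (hf.periodic j)
  have := fderiv_comp_add_right (𝕜 := ℝ) (f := f) (x := x) (Pi.single j (L j))
  rw [h] at this
  simp only [FCH.pderiv, this]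

lemma pderiv_mul (hf : IsTest L f) (hg : IsTest L g) (i : Fin d) (x : Fin d → ℝ) :
    pderiv i (f * g) x = pderiv i f x * g x + f x * pderiv i g x := by
  simp only [pderiv, fderiv_mul (hf.differentiableAt x) (hg.differentiableAt x)]
  simp
  ring

lemma pderiv_pow (hf : IsTest L f) (n : ℕ) (i : Fin d) (x : Fin d → ℝ) :
    pderiv i (fun y => f y ^ n) x = n * f x ^ (n - 1) * pderiv i f x := by
  simp only [pderiv]
  rw [((hf.differentiableAt x).hasFDerivAt.pow n).fderiv]
  simp

lemma IsTest.continuous (hf : IsTest L f) : Continuous f := hf.smooth.continuous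

lemma memLp_of_continuous (hf : Continuous f) (p : ℝ≥0∞) :
    MemLp f p (volume.restrict (cell L)) := by
  obtain ⟨C, hC⟩ := (isCompact_Icc (a := (0 : Fin d → ℝ)) (b := L)).exists_bound_of_continuousOn
    hf.continuousOn
  refine MemLp.of_bound hf.aestronglyMeasurable C ?_
  refine (ae_restrict_iff' (MeasurableSet.univ_pi fun i => measurableSet_Ioo)).2
    (.of_forall fun x hx => hC x ?_)
  exact ⟨fun i => (hx i trivial).1.le, fun i => (hx i trivial).2.le⟩

lemma IsTest.memLp (hf : IsTest L f) (p : ℝ≥0∞) : MemLp f p (volume.restrict (cell L)) :=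
  memLp_of_continuous hf.continuous p

lemma IsTest.integrable (hf : IsTest L f) : Integrable f (volume.restrict (cell L)) :=
  memLp_one_iff_integrable.1 (hf.memLp 1)

/-- The divergence theorem on the cell: opposite faces cancel by periodicity. -/
theorem IsTest.integral_pderiv_eq_zero (hL : ∀ i, 0 < L i) (hf : IsTest L f) (i : Fin d) :
    ∫ x in cell L, FCH.pderiv i f x = 0 := by
  obtain _ | n := d
  · exact i.elim0
  have hsingle : ∀ y : Fin n → ℝ, i.insertNth (L i) y
      = i.insertNth (0 : ℝ) y + (Pi.single i (L i) : Fin (n + 1) → ℝ) := by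
    intro y
    ext j
    refine Fin.succAboveCases i ?_ (fun k => ?_) j <;> simp
  have hcell : ∫ x in cell L, FCH.pderiv i f x = ∫ x in Set.Icc 0 L, FCH.pderiv i f x :=
    setIntegral_congr_set Measure.univ_pi_Ioo_ae_eq_Icc
  have hz : (fun x => ∑ j, (if j = i then fderiv ℝ f x else 0) (Pi.single j 1))
      = FCH.pderiv i f := by
    ext x
    rw [Finset.sum_eq_single i (fun j _ hj => by simp [hj]) (by simp)]
    simp [FCH.pderiv]
  have h := integral_divergence_of_hasFDerivAt_off_countable' (0 : Fin (n + 1) → ℝ) L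
    (fun j => (hL j).le) (fun j => if j = i then f else 0)
    (fun j x => if j = i then fderiv ℝ f x else 0) ∅ Set.countable_empty
    (fun j => by
      by_cases hj : j = i
      · simp only [hj, if_true]; exact hf.continuous.continuousOn
      · simp only [hj, if_false]; exact continuousOn_const)
    (fun x _ j => by
      by_cases hj : j = i
      · simp only [hj, if_true]; exact (hf.differentiableAt x).hasFDerivAt
      · simp only [hj, if_false]; exact hasFDerivAt_const 0 x)
    (by
      rw [hz]
      exact (hf.pderiv i).continuous.continuousOn.integrableOn_compact isCompact_Icc)
  rw [congrArg (fun g => ∫ x in Set.Icc 0 L, g x) hz] at h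
  rw [hcell, h]
  refine Finset.sum_eq_zero fun j _ => ?_
  by_cases hj : j = i
  · subst hj
    simp only [if_true, hsingle, Pi.zero_apply, hf.periodic j _, sub_self]
  · simp [hj]

/-- The Gagliardo–Nirenberg inequality `‖∂ᵢf‖₄² ≤ 3 ‖f‖_∞ ‖∂ᵢ∂ᵢf‖₂` for smooth periodic functions,
obtained by integrating `∂ᵢ(f (∂ᵢf)³)`. -/
theorem IsTest.integral_pderiv_pow_four_le (hL : ∀ i, 0 < L i) (hf : IsTest L f) (i : Fin d)
    {M : ℝ} (hM : ∀ x, |f x| ≤ M) :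
    ∫ x in cell L, FCH.pderiv i f x ^ 4
      ≤ 9 * M ^ 2 * ∫ x in cell L, FCH.pderiv i (FCH.pderiv i f) x ^ 2 := by
  have hp := hf.pderiv i
  have hpp := hp.pderiv i
  have h0 := (hf.mul (hp.pow 3)).integral_pderiv_eq_zero hL i
  have hpt : ∀ x, FCH.pderiv i (f * fun x => FCH.pderiv i f x ^ 3) x
      = FCH.pderiv i f x ^ 4
        + f x * (3 * FCH.pderiv i f x ^ 2 * FCH.pderiv i (FCH.pderiv i f) x) := by
    intro x
    rw [pderiv_mul hf (hp.pow 3), pderiv_pow hp]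
    push_cast
    ring
  have hbd : ∀ x, FCH.pderiv i f x ^ 4 / 2
      ≤ FCH.pderiv i (f * fun x => FCH.pderiv i f x ^ 3) x
        + 9 * M ^ 2 / 2 * FCH.pderiv i (FCH.pderiv i f) x ^ 2 := by
    intro x
    rw [hpt]
    set a := FCH.pderiv i f x
    set b := FCH.pderiv i (FCH.pderiv i f) x
    have h1 : f x ^ 2 ≤ M ^ 2 := sq_le_sq' (abs_le.1 (hM x)).1 (abs_le.1 (hM x)).2
    nlinarith [sq_nonneg (a ^ 2 + 3 * f x * b), mul_le_mul_of_nonneg_right h1 (sq_nonneg b)]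
  have i1 := (hp.pow 4).integrable
  have i2 := ((hf.mul (hp.pow 3)).pderiv i).integrable
  have i3 := (hpp.pow 2).integrable
  have := integral_mono (i1.div_const 2) (i2.add (i3.const_mul (9 * M ^ 2 / 2))) hbd
  rw [integral_add' i2 (i3.const_mul _), h0, integral_div, integral_const_mul] at this
  linarith

end Test

/-! ### Weak derivatives of Fourier series -/

section Fourier

variable {d : ℕ} {L : Fin d → ℝ} {u v : (Fin d → ℝ) → ℝ}

lemma hasFDerivAt_phase (k : Fin d → ℤ) (x : Fin d → ℝ) :
    HasFDerivAt (phase L k)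
      (∑ i, (2 * Real.pi * k i / L i)
        • ContinuousLinearMap.proj (R := ℝ) (φ := fun _ => ℝ) i) x := by
  unfold phase
  exact HasFDerivAt.fun_sum fun i _ => (hasFDerivAt_apply i x).const_mul _

lemma contDiff_phase (k : Fin d → ℤ) : ContDiff ℝ ∞ (phase L k) := by
  unfold phase; fun_prop

lemma phase_add_single (hL : ∀ i, 0 < L i) (k : Fin d → ℤ) (i : Fin d) (x : Fin d → ℝ) :
    phase L k (x + Pi.single i (L i)) = phase L k x + k i * (2 * Real.pi) := by
  simp only [phase, Pi.add_apply, mul_add, Finset.sum_add_distrib]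
  congr 1
  rw [Finset.sum_eq_single i (fun j _ hj => by simp [hj]) (by simp)]
  have := (hL i).ne'
  simp
  field_simp

lemma isTest_cos_phase (hL : ∀ i, 0 < L i) (k : Fin d → ℤ) :
    IsTest L (fun x => Real.cos (phase L k x)) :=
  ⟨(contDiff_phase k).cos, fun i x => by
    rw [phase_add_single hL, Real.cos_add_int_mul_two_pi]⟩

lemma isTest_sin_phase (hL : ∀ i, 0 < L i) (k : Fin d → ℤ) :
    IsTest L (fun x => Real.sin (phase L k x)) :=
  ⟨(contDiff_phase k).sin, fun i x => by
    rw [phase_add_single hL, Real.sin_add_int_mul_two_pi]⟩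

lemma fderiv_cos_phase (k : Fin d → ℤ) (i : Fin d) (x : Fin d → ℝ) :
    fderiv ℝ (fun x => Real.cos (phase L k x)) x (Pi.single i 1)
      = -(2 * Real.pi * k i / L i) * Real.sin (phase L k x) := by
  rw [(hasFDerivAt_phase k x).cos.fderiv]
  simp [Pi.single_apply]
  ring

lemma fderiv_sin_phase (k : Fin d → ℤ) (i : Fin d) (x : Fin d → ℝ) :
    fderiv ℝ (fun x => Real.sin (phase L k x)) x (Pi.single i 1)
      = (2 * Real.pi * k i / L i) * Real.cos (phase L k x) := by
  rw [(hasFDerivAt_phase k x).sin.fderiv]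
  simp [Pi.single_apply]
  ring

lemma isTest_fourierSum (hL : ∀ i, 0 < L i) (F : Finset (Fin d → ℤ)) (u : (Fin d → ℝ) → ℝ) :
    IsTest L (fourierSum L F u) := by
  refine ⟨?_, fun i x => ?_⟩
  · unfold fourierSum
    exact ContDiff.sum fun k _ => (contDiff_const.mul (contDiff_phase k).cos).add
      (contDiff_const.mul (contDiff_phase k).sin)
  · refine Finset.sum_congr rfl fun k _ => ?_
    rw [phase_add_single hL, Real.cos_add_int_mul_two_pi, Real.sin_add_int_mul_two_pi]

lemma IsWeakPartial.cosCoeff_eq (hL : ∀ i, 0 < L i) {i : Fin d} (h : IsWeakPartial L i u v)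
    (k : Fin d → ℤ) : cosCoeff L v k = (2 * Real.pi * k i / L i) * sinCoeff L u k := by
  have := h _ (isTest_cos_phase hL k)
  simp only [fderiv_cos_phase, mul_left_comm (u _), integral_const_mul] at this
  simp only [cosCoeff, sinCoeff]
  linear_combination (∏ i, L i)⁻¹ * this

lemma IsWeakPartial.sinCoeff_eq (hL : ∀ i, 0 < L i) {i : Fin d} (h : IsWeakPartial L i u v)
    (k : Fin d → ℤ) : sinCoeff L v k = -(2 * Real.pi * k i / L i) * cosCoeff L u k := by
  have := h _ (isTest_sin_phase hL k)
  simp only [fderiv_sin_phase, mul_left_comm (u _), integral_const_mul] at this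
  simp only [cosCoeff, sinCoeff]
  linear_combination (∏ i, L i)⁻¹ * this

/-- Partial Fourier sums commute with weak derivatives. -/
lemma IsWeakPartial.pderiv_fourierSum (hL : ∀ i, 0 < L i) {i : Fin d} (h : IsWeakPartial L i u v)
    (F : Finset (Fin d → ℤ)) : pderiv i (fourierSum L F u) = fourierSum L F v := by
  ext x
  have hd : ∀ k ∈ F, DifferentiableAt ℝ (fun x => cosCoeff L u k * Real.cos (phase L k x)
      + sinCoeff L u k * Real.sin (phase L k x)) x := fun k _ =>
    (((isTest_cos_phase hL k).differentiableAt x).const_mul _).add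
      (((isTest_sin_phase hL k).differentiableAt x).const_mul _)
  unfold pderiv fourierSum
  rw [fderiv_fun_sum hd, sum_apply]
  refine Finset.sum_congr rfl fun k _ => ?_
  rw [fderiv_fun_add (((isTest_cos_phase hL k).differentiableAt x).const_mul _)
      (((isTest_sin_phase hL k).differentiableAt x).const_mul _),
    fderiv_const_mul ((isTest_cos_phase hL k).differentiableAt x),
    fderiv_const_mul ((isTest_sin_phase hL k).differentiableAt x)]
  simp only [add_apply, smul_apply, smul_eq_mul,
    fderiv_cos_phase, fderiv_sin_phase, h.cosCoeff_eq hL, h.sinCoeff_eq hL]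
  ring

end Fourier

/-! ### Uniqueness and linearity of weak derivatives -/

section WeakPartial

variable {d : ℕ} {L : Fin d → ℝ} {u u' v v' w : (Fin d → ℝ) → ℝ} {i : Fin d}

/-- An `L²` function is determined by its Fourier series. -/
lemma ae_eq_of_fourierSum_eq (hL : ∀ i, 0 < L i) (hu : MemL2 L u) (hv : MemL2 L v)
    (h : ∀ F, fourierSum L F u = fourierSum L F v) : u =ᵐ[volume.restrict (cell L)] v := by
  have h1 := tendsto_fourierSum hL hu
  have h2 := tendsto_fourierSum hL hv
  have h3 := (h1.add h2)
  rw [add_zero] at h3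
  have hm : ∀ F, AEStronglyMeasurable (fourierSum L F u) (volume.restrict (cell L)) := fun F =>
    (isTest_fourierSum hL F u).continuous.aestronglyMeasurable
  have h4 : eLpNorm (u - v) 2 (volume.restrict (cell L)) = 0 := by
    refine le_antisymm (ge_of_tendsto h3 (.of_forall fun F => ?_)) zero_le
    rw [eLpNorm_sub_comm (fourierSum L F u) u, ← h F]
    have := eLpNorm_add_le (p := 2) (hu.aestronglyMeasurable.sub (hm F))
      ((hm F).sub hv.aestronglyMeasurable) one_le_two
    simpa using this
  rw [eLpNorm_eq_zero_iff (hu.aestronglyMeasurable.sub hv.aestronglyMeasurable) two_ne_zero] at h4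
  filter_upwards [h4] with x hx
  simpa [sub_eq_zero] using hx

lemma IsWeakPartial.ae_eq (hL : ∀ i, 0 < L i) (hv : MemL2 L v) (hv' : MemL2 L v')
    (h : IsWeakPartial L i u v) (h' : IsWeakPartial L i u v') :
    v =ᵐ[volume.restrict (cell L)] v' :=
  ae_eq_of_fourierSum_eq hL hv hv' fun F => by
    rw [← h.pderiv_fourierSum hL, ← h'.pderiv_fourierSum hL]

lemma MemH1.memL2_weakPartial (hu : MemH1 L u) (i : Fin d) : MemL2 L (weakPartial L i u) := by
  have h := hu.exists_partial i
  rw [weakPartial, dif_pos h]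
  exact h.choose_spec.1

lemma MemH1.isWeakPartial (hu : MemH1 L u) (i : Fin d) :
    IsWeakPartial L i u (weakPartial L i u) := by
  have h := hu.exists_partial i
  rw [weakPartial, dif_pos h]
  exact h.choose_spec.2

lemma IsWeakPartial.congr_left (h : IsWeakPartial L i u v)
    (hu : u =ᵐ[volume.restrict (cell L)] u') : IsWeakPartial L i u' v := by
  intro ψ hψ
  rw [← h ψ hψ]
  refine integral_congr_ae ?_
  filter_upwards [hu] with x hx
  rw [hx]

lemma MemH1.congr (hu : MemH1 L u) (h : u =ᵐ[volume.restrict (cell L)] u') : MemH1 L u' :=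
  ⟨MemLp.ae_eq h hu.memL2, fun i =>
    ⟨_, hu.memL2_weakPartial i, (hu.isWeakPartial i).congr_left h⟩⟩

lemma MemH1.weakPartial_ae_eq (hL : ∀ i, 0 < L i) (hu : MemH1 L u) (hv : MemL2 L v)
    (h : IsWeakPartial L i u v) : weakPartial L i u =ᵐ[volume.restrict (cell L)] v :=
  (hu.isWeakPartial i).ae_eq hL (hu.memL2_weakPartial i) hv h

lemma MemL2.integrable_mul (hu : MemL2 L u) (hv : MemL2 L v) :
    Integrable (fun x => u x * v x) (volume.restrict (cell L)) :=
  MemLp.integrable_mul hu hv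

lemma IsWeakPartial.sub (hu : MemL2 L u) (hu' : MemL2 L u') (hv : MemL2 L v) (hv' : MemL2 L v')
    (h : IsWeakPartial L i u v) (h' : IsWeakPartial L i u' v') :
    IsWeakPartial L i (u - u') (v - v') := by
  intro ψ hψ
  have hψ2 : MemL2 L ψ := hψ.memLp 2
  have hψ' : MemL2 L (fun x => fderiv ℝ ψ x (Pi.single i 1)) := (hψ.pderiv i).memLp 2
  simp only [Pi.sub_apply, sub_mul]
  rw [integral_sub (hu.integrable_mul hψ') (hu'.integrable_mul hψ'),
    integral_sub (hv.integrable_mul hψ2) (hv'.integrable_mul hψ2), h ψ hψ, h' ψ hψ]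
  ring

lemma MemL2.sub (hu : MemL2 L u) (hv : MemL2 L v) : MemL2 L (u - v) := MemLp.sub hu hv

lemma MemH1.isWeakPartial_sub (hu : MemH1 L u) (hv : MemH1 L v) (i : Fin d) :
    IsWeakPartial L i (u - v) (weakPartial L i u - weakPartial L i v) :=
  (hu.isWeakPartial i).sub hu.memL2 hv.memL2 (hu.memL2_weakPartial i) (hv.memL2_weakPartial i)
    (hv.isWeakPartial i)

lemma MemH1.sub (hu : MemH1 L u) (hv : MemH1 L v) : MemH1 L (u - v) :=
  ⟨hu.memL2.sub hv.memL2, fun i =>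
    ⟨_, (hu.memL2_weakPartial i).sub (hv.memL2_weakPartial i), hu.isWeakPartial_sub hv i⟩⟩

lemma MemH1.weakPartial_sub (hL : ∀ i, 0 < L i) (hu : MemH1 L u) (hv : MemH1 L v) (i : Fin d) :
    weakPartial L i (u - v)
      =ᵐ[volume.restrict (cell L)] weakPartial L i u - weakPartial L i v :=
  (hu.sub hv).weakPartial_ae_eq hL ((hu.memL2_weakPartial i).sub (hv.memL2_weakPartial i))
    (hu.isWeakPartial_sub hv i)

lemma MemH2.sub (hL : ∀ i, 0 < L i) (hu : MemH2 L u) (hv : MemH2 L v) : MemH2 L (u - v) :=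
  ⟨hu.memH1.sub hv.memH1, fun i => ((hu.partial_memH1 i).sub (hv.partial_memH1 i)).congr
    (hu.memH1.weakPartial_sub hL hv.memH1 i).symm⟩

lemma MemH2.weakPartial_weakPartial_sub (hL : ∀ i, 0 < L i) (hu : MemH2 L u) (hv : MemH2 L v)
    (i j : Fin d) : weakPartial L j (weakPartial L i (u - v)) =ᵐ[volume.restrict (cell L)]
      weakPartial L j (weakPartial L i u) - weakPartial L j (weakPartial L i v) :=
  ((hu.sub hL hv).partial_memH1 i).weakPartial_ae_eq hL
    (((hu.partial_memH1 i).memL2_weakPartial j).sub ((hv.partial_memH1 i).memL2_weakPartial j))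
    (((hu.partial_memH1 i).isWeakPartial_sub (hv.partial_memH1 i) j).congr_left
      (hu.memH1.weakPartial_sub hL hv.memH1 i).symm)

lemma MemH2.lap_sub (hL : ∀ i, 0 < L i) (hu : MemH2 L u) (hv : MemH2 L v) :
    lap L (u - v) =ᵐ[volume.restrict (cell L)] lap L u - lap L v := by
  have := ae_all_iff.2 fun i => hu.weakPartial_weakPartial_sub hL hv i i
  filter_upwards [this] with x hx
  simp only [lap, hx, Pi.sub_apply, Finset.sum_sub_distrib]

lemma MemH2.memL2_lap (hu : MemH2 L u) : MemL2 L (lap L u) := by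
  unfold MemL2 lap
  exact memLp_finsetSum _ fun i _ => (hu.partial_memH1 i).memL2_weakPartial i

end WeakPartial

/-! ### Sobolev embeddings of `H²` in dimension at most three -/

section Sobolev

variable {d : ℕ} {L : Fin d → ℝ} {u : (Fin d → ℝ) → ℝ}

/-- `∑ ‖k‖⁻⁴` converges over `ℤ^d` for `d ≤ 3`: this is where the dimension enters. -/
lemma summable_norm_inv_pow_four (hd : d ≤ 3) : Summable fun k : Fin d → ℤ => (‖k‖ ^ 4)⁻¹ := by
  set Λ : Submodule ℤ (Fin d → ℝ) := Submodule.span ℤ (Set.range (Pi.basisFun ℝ (Fin d))) with hΛ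
  have hrank : Module.finrank ℤ Λ = d := by
    rw [ZLattice.rank ℝ Λ]; simp
  have h := ZLattice.summable_norm_pow_inv (L := Λ) 4 (by omega)
  have hmem : ∀ k : Fin d → ℤ, (fun i => (k i : ℝ)) ∈ Λ := by
    intro k
    have : (fun i => (k i : ℝ)) = ∑ i, k i • Pi.basisFun ℝ (Fin d) i := by
      ext j
      simp [Finset.sum_apply, Pi.single_apply]
    rw [this]
    exact Submodule.sum_mem _ fun i _ => Submodule.smul_mem _ _ (Submodule.subset_span ⟨i, rfl⟩)
  have hinj : Function.Injective fun k : Fin d → ℤ => (⟨fun i => (k i : ℝ), hmem k⟩ : Λ) := by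
    intro k l hkl
    ext i
    have : (k i : ℝ) = l i := congrFun (Subtype.ext_iff.1 hkl) i
    exact_mod_cast this
  refine (h.comp_injective hinj).congr fun k => ?_
  have hcast : ∀ b, ‖(k b : ℝ)‖₊ = ‖k b‖₊ := fun b => NNReal.eq (Int.norm_cast_real _)
  simp only [Function.comp_def, Submodule.coe_norm, Pi.norm_def, hcast, inv_pow]

lemma MemH2.coeff_weakPartial_weakPartial (hL : ∀ i, 0 < L i) (hu : MemH2 L u) (i j : Fin d)
    (k : Fin d → ℤ) :
    cosCoeff L (weakPartial L j (weakPartial L i u)) k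
        = -((2 * Real.pi * k i / L i) * (2 * Real.pi * k j / L j) * cosCoeff L u k) ∧
      sinCoeff L (weakPartial L j (weakPartial L i u)) k
        = -((2 * Real.pi * k i / L i) * (2 * Real.pi * k j / L j) * sinCoeff L u k) := by
  have h1 := hu.memH1.isWeakPartial i
  have h2 := (hu.partial_memH1 i).isWeakPartial j
  rw [h2.cosCoeff_eq hL, h2.sinCoeff_eq hL, h1.cosCoeff_eq hL, h1.sinCoeff_eq hL]
  constructor <;> ring

/-- The Fourier series of an `H²` function converges absolutely in dimension at most three: by
Parseval's identity for the `∂ᵢ∂ᵢu`, the squared coefficients are summable with weight `‖k‖⁴`. -/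
theorem MemH2.summable_coeff (hd : d ≤ 3) (hL : ∀ i, 0 < L i) (hu : MemH2 L u) :
    Summable fun k => |cosCoeff L u k| + |sinCoeff L u k| := by
  set r : (Fin d → ℤ) → ℝ := fun k => cosCoeff L u k ^ 2 + sinCoeff L u k ^ 2 with hr
  have hr0 : ∀ k, 0 ≤ r k := fun k => by positivity
  have h1 : ∀ i, Summable fun k : Fin d → ℤ => (k i : ℝ) ^ 4 * r k := by
    intro i
    have := (hasSum_sq_coeff hL ((hu.partial_memH1 i).memL2_weakPartial i)).summable
    refine (this.mul_left ((L i / (2 * Real.pi)) ^ 4)).congr fun k => ?_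
    rw [(hu.coeff_weakPartial_weakPartial hL i i k).1,
      (hu.coeff_weakPartial_weakPartial hL i i k).2, hr]
    have := (hL i).ne'
    have := Real.pi_ne_zero
    field_simp
  have h2 : Summable fun k : Fin d → ℤ => ∑ i, (k i : ℝ) ^ 4 * r k :=
    summable_sum fun i _ => h1 i
  refine Summable.of_norm_bounded_eventually (h2.add (summable_norm_inv_pow_four hd)) ?_
  rw [Filter.eventually_cofinite]
  refine (Set.finite_singleton (0 : Fin d → ℤ)).subset fun k hk => ?_
  by_contra hk0
  apply hk
  have hpos : 0 < ‖k‖ := norm_pos_iff.2 hk0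
  have hle : ‖k‖ ^ 4 ≤ ∑ i, (k i : ℝ) ^ 4 := by
    have hne : Nonempty (Fin d) := by
      by_contra h
      rw [not_nonempty_iff] at h
      exact hk0 (Subsingleton.elim _ _)
    obtain ⟨i, hi⟩ : ∃ i, ‖k i‖ = ‖k‖ := by
      obtain ⟨i, -, hi⟩ := Finset.exists_mem_eq_sup' Finset.univ_nonempty fun i => ‖k i‖
      refine ⟨i, ?_⟩
      rw [← hi]
      refine le_antisymm (hi ▸ norm_le_pi_norm k i) ?_
      exact (pi_norm_le_iff_of_nonempty _).2 fun j =>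
        Finset.le_sup' (fun i => ‖k i‖) (Finset.mem_univ j)
    rw [← hi, Int.norm_eq_abs, ← abs_pow, abs_of_nonneg (by positivity)]
    exact Finset.single_le_sum (f := fun i => (k i : ℝ) ^ 4) (fun j _ => by positivity)
      (Finset.mem_univ i)
  rw [← Finset.sum_mul, Real.norm_of_nonneg (by positivity)]
  have h3 := mul_le_mul_of_nonneg_right hle (hr0 k)
  -- `2|a| ≤ ‖k‖⁴ a² + ‖k‖⁻⁴`
  have key : ∀ a : ℝ, |a| ≤ ‖k‖ ^ 4 * a ^ 2 + (‖k‖ ^ 4)⁻¹ / 4 := by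
    intro a
    have hN : 0 < ‖k‖ ^ 4 := by positivity
    set N := ‖k‖ ^ 4
    have : ‖k‖ ^ 4 * a ^ 2 + (‖k‖ ^ 4)⁻¹ / 4 - |a| = N * (|a| - N⁻¹ / 2) ^ 2 := by
      rw [← sq_abs a]
      simp only [N]
      field_simp
      ring
    have h4 : 0 ≤ N * (|a| - N⁻¹ / 2) ^ 2 := by positivity
    linarith
  have hA := key (cosCoeff L u k)
  have hB := key (sinCoeff L u k)
  have : (0 : ℝ) < (‖k‖ ^ 4)⁻¹ := by positivity
  simp only [hr] at h3 ⊢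
  linarith

/-- The partial Fourier sums of an `H²` function are uniformly bounded: the Sobolev embedding
`H² ⊂ L^∞`. -/
theorem MemH2.exists_abs_fourierSum_le (hd : d ≤ 3) (hL : ∀ i, 0 < L i) (hu : MemH2 L u) :
    ∃ M, ∀ F x, |fourierSum L F u x| ≤ M := by
  refine ⟨∑' k, (|cosCoeff L u k| + |sinCoeff L u k|), fun F x => ?_⟩
  refine (Finset.abs_sum_le_sum_abs _ _).trans ((Finset.sum_le_sum fun k _ => ?_).trans
    ((hu.summable_coeff hd hL).sum_le_tsum F fun k _ => by positivity))
  refine (abs_add_le _ _).trans (add_le_add ?_ ?_) <;> rw [abs_mul]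
  · exact mul_le_of_le_one_right (abs_nonneg _) (Real.abs_cos_le_one _)
  · exact mul_le_of_le_one_right (abs_nonneg _) (Real.abs_sin_le_one _)

lemma MemL2.exists_seq_fourierSum_tendsto (hL : ∀ i, 0 < L i) (hu : MemL2 L u) :
    ∃ F : ℕ → Finset (Fin d → ℤ), Tendsto F atTop atTop ∧
      ∀ᵐ x ∂volume.restrict (cell L), Tendsto (fun n => fourierSum L (F n) u x) atTop
        (𝓝 (u x)) :=
  (tendstoInMeasure_of_tendsto_eLpNorm two_ne_zero
    (fun F => (isTest_fourierSum hL F u).continuous.aestronglyMeasurable)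
    hu.aestronglyMeasurable (tendsto_fourierSum hL hu)).exists_seq_tendsto_ae'

theorem MemH2.memLp_top (hd : d ≤ 3) (hL : ∀ i, 0 < L i) (hu : MemH2 L u) :
    MemLp u ⊤ (volume.restrict (cell L)) := by
  obtain ⟨M, hM⟩ := hu.exists_abs_fourierSum_le hd hL
  obtain ⟨F, -, hF⟩ := hu.memH1.memL2.exists_seq_fourierSum_tendsto hL
  refine memLp_top_of_bound hu.memH1.memL2.aestronglyMeasurable M ?_
  filter_upwards [hF] with x hx
  exact le_of_tendsto hx.norm (.of_forall fun n => hM (F n) x)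

lemma IsTest.ofReal_integral_sq {f : (Fin d → ℝ) → ℝ} (hf : IsTest L f) :
    ENNReal.ofReal (∫ x in cell L, f x ^ 2) = eLpNorm f 2 (volume.restrict (cell L)) ^ 2 := by
  have h1 := ofReal_integral_norm_eq_lintegral_enorm (hf.pow 2).integrable
  have h2 := eLpNorm_nnreal_pow_eq_lintegral (f := f) (μ := volume.restrict (cell L))
    (p := 2) two_ne_zero
  simp only [NNReal.coe_ofNat, ENNReal.coe_ofNat, ENNReal.rpow_ofNat] at h2
  rw [h2]
  simpa [enorm_pow] using h1

/-- First derivatives of `H²` functions are in `L⁴`: the Gagliardo–Nirenberg inequality bounds the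
partial Fourier sums, and Fatou's lemma passes to the limit. -/
theorem MemH2.memLp_weakPartial_four (hd : d ≤ 3) (hL : ∀ i, 0 < L i) (hu : MemH2 L u)
    (i : Fin d) : MemLp (weakPartial L i u) 4 (volume.restrict (cell L)) := by
  obtain ⟨M, hM⟩ := hu.exists_abs_fourierSum_le hd hL
  set p := weakPartial L i u
  set q := weakPartial L i p
  have hp := hu.memH1.memL2_weakPartial i
  have hq := (hu.partial_memH1 i).memL2_weakPartial i
  obtain ⟨F, hF, hFae⟩ := hp.exists_seq_fourierSum_tendsto hL
  have hlim := (tendsto_fourierSum hL hq).comp hF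
  have hev : ∀ᶠ n in atTop, ∫⁻ x in cell L, ‖fourierSum L (F n) p x ^ 4‖ₑ
      ≤ ENNReal.ofReal (9 * M ^ 2) * (1 + eLpNorm q 2 (volume.restrict (cell L))) ^ 2 := by
    filter_upwards [hlim.eventually (ge_mem_nhds zero_lt_one)] with n hn
    have ht := isTest_fourierSum hL (F n) u
    have htp := isTest_fourierSum hL (F n) p
    have htq := isTest_fourierSum hL (F n) q
    have hGN := ht.integral_pderiv_pow_four_le hL i (hM (F n))
    rw [(hu.memH1.isWeakPartial i).pderiv_fourierSum hL,
      ((hu.partial_memH1 i).isWeakPartial i).pderiv_fourierSum hL] at hGN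
    have h1 := ofReal_integral_norm_eq_lintegral_enorm (htp.pow 4).integrable
    have h2 : ∀ x, ‖fourierSum L (F n) p x ^ 4‖ = fourierSum L (F n) p x ^ 4 := fun x =>
      Real.norm_of_nonneg (by positivity)
    simp only [h2] at h1
    rw [← h1]
    refine (ENNReal.ofReal_le_ofReal hGN).trans ?_
    rw [ENNReal.ofReal_mul (by positivity), htq.ofReal_integral_sq]
    gcongr
    have h3 := eLpNorm_add_le (p := 2) (f := fourierSum L (F n) q - q) (g := q)
      (htq.continuous.aestronglyMeasurable.sub hq.aestronglyMeasurable)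
      hq.aestronglyMeasurable one_le_two
    rw [sub_add_cancel] at h3
    exact h3.trans (add_le_add hn le_rfl)
  have hint : Integrable (fun x => p x ^ 4) (volume.restrict (cell L)) := by
    have hm : ∀ n, AEStronglyMeasurable (fun x => fourierSum L (F n) p x ^ 4)
        (volume.restrict (cell L)) := fun n =>
      ((isTest_fourierSum hL (F n) p).pow 4).continuous.aestronglyMeasurable
    have hae : ∀ᵐ x ∂volume.restrict (cell L),
        Tendsto (fun n => fourierSum L (F n) p x ^ 4) atTop (𝓝 (p x ^ 4)) := by
      filter_upwards [hFae] with x hx using hx.pow 4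
    refine ⟨aestronglyMeasurable_of_tendsto_ae _ hm hae, ?_⟩
    have hfatou : ∫⁻ x in cell L, ‖p x ^ 4‖ₑ
        ≤ liminf (fun n => ∫⁻ x in cell L, ‖fourierSum L (F n) p x ^ 4‖ₑ) atTop := by
      refine (lintegral_congr_ae ?_).trans_le (lintegral_liminf_le' fun n => (hm n).enorm)
      filter_upwards [hae] with x hx using hx.enorm.liminf_eq.symm
    refine (hfatou.trans (liminf_le_of_frequently_le' hev.frequently)).trans_lt
      (lt_top_iff_ne_top.2 ?_)
    refine ENNReal.mul_ne_top ENNReal.ofReal_ne_top (ENNReal.pow_ne_top ?_)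
    exact ENNReal.add_ne_top.2 ⟨ENNReal.one_ne_top, hq.eLpNorm_ne_top⟩
  rw [← integrable_norm_rpow_iff hp.aestronglyMeasurable (by norm_num) (by norm_num)]
  refine hint.congr (.of_forall fun x => ?_)
  have h4 : (4 : ℝ≥0∞).toReal = ((4 : ℕ) : ℝ) := by simp
  simp only [h4, Real.rpow_natCast, Real.norm_eq_abs]
  rw [← abs_pow, abs_of_nonneg (by positivity)]

end Sobolev

/-! ### Integration by parts -/

section IntegralIdentities

variable {d : ℕ} {L : Fin d → ℝ} {u w : (Fin d → ℝ) → ℝ}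

/-- Convergence of `∫ hₙ g fₙ` when `fₙ → f` in `L²` and the `hₙ` are uniformly bounded and converge
almost everywhere. -/
lemma tendsto_integral_mul_mul {h : ℕ → (Fin d → ℝ) → ℝ} {h₀ : (Fin d → ℝ) → ℝ}
    {f : ℕ → (Fin d → ℝ) → ℝ} {f₀ g : (Fin d → ℝ) → ℝ} {C : ℝ}
    (hm : ∀ n, AEStronglyMeasurable (h n) (volume.restrict (cell L)))
    (hC : ∀ n x, |h n x| ≤ C)
    (hlim : ∀ᵐ x ∂volume.restrict (cell L), Tendsto (fun n => h n x) atTop (𝓝 (h₀ x)))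
    (hf : ∀ n, MemL2 L (f n)) (hf₀ : MemL2 L f₀) (hg : MemL2 L g)
    (hfl : Tendsto (fun n => eLpNorm (f n - f₀) 2 (volume.restrict (cell L))) atTop (𝓝 0)) :
    Tendsto (fun n => ∫ x in cell L, h n x * (g x * f n x)) atTop
      (𝓝 (∫ x in cell L, h₀ x * (g x * f₀ x))) := by
  have hsub : ∀ n, MemL2 L (f n - f₀) := fun n => (hf n).sub hf₀
  have i1 : ∀ n, Integrable (fun x => h n x * (g x * (f n - f₀) x)) (volume.restrict (cell L)) :=
    fun n => (hg.integrable_mul (hsub n)).bdd_mul (c := C) (hm n) (.of_forall (hC n))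
  have i2 : ∀ n, Integrable (fun x => h n x * (g x * f₀ x)) (volume.restrict (cell L)) :=
    fun n => (hg.integrable_mul hf₀).bdd_mul (c := C) (hm n) (.of_forall (hC n))
  have hsplit : ∀ n, ∫ x in cell L, h n x * (g x * f n x)
      = (∫ x in cell L, h n x * (g x * (f n - f₀) x)) + ∫ x in cell L, h n x * (g x * f₀ x) := by
    intro n
    rw [← integral_add (i1 n) (i2 n)]
    refine integral_congr_ae (.of_forall fun x => ?_)
    simp only [Pi.sub_apply]
    ring
  have h2 : Tendsto (fun n => ∫ x in cell L, h n x * (g x * f₀ x)) atTop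
      (𝓝 (∫ x in cell L, h₀ x * (g x * f₀ x))) := by
    refine tendsto_integral_of_dominated_convergence (fun x => C * |g x * f₀ x|)
      (fun n => (i2 n).aestronglyMeasurable) ((hg.integrable_mul hf₀).abs.const_mul C)
      (fun n => .of_forall fun x => ?_) ?_
    · rw [norm_mul]
      exact mul_le_mul_of_nonneg_right (hC n x) (abs_nonneg _)
    · filter_upwards [hlim] with x hx using hx.mul_const _
  have h1 : Tendsto (fun n => ∫ x in cell L, h n x * (g x * (f n - f₀) x)) atTop (𝓝 0) := by
    have hbd : ∀ n, eLpNorm (fun x => h n x * (g x * (f n - f₀) x)) 1 (volume.restrict (cell L))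
        ≤ ENNReal.ofReal C * (eLpNorm g 2 (volume.restrict (cell L))
          * eLpNorm (f n - f₀) 2 (volume.restrict (cell L))) := by
      intro n
      refine (eLpNorm_le_mul_eLpNorm_of_ae_le_mul (g := fun x => g x * (f n - f₀) x) (c := C)
        (.of_forall fun x => ?_) 1).trans ?_
      · rw [norm_mul]
        exact mul_le_mul_of_nonneg_right (hC n x) (norm_nonneg _)
      · exact mul_le_mul_right (eLpNorm_smul_le_mul_eLpNorm (p := 2) (q := 2) (r := 1)
          (f := f n - f₀) (φ := g) (hsub n).aestronglyMeasurable hg.aestronglyMeasurable) _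
    have hz : Tendsto (fun n => ENNReal.ofReal C * (eLpNorm g 2 (volume.restrict (cell L))
          * eLpNorm (f n - f₀) 2 (volume.restrict (cell L)))) atTop (𝓝 0) := by
      have := ENNReal.Tendsto.const_mul (a := ENNReal.ofReal C)
        (ENNReal.Tendsto.const_mul (a := eLpNorm g 2 (volume.restrict (cell L))) hfl
          (Or.inr hg.eLpNorm_ne_top)) (Or.inr ENNReal.ofReal_ne_top)
      simpa using this
    have hL1 := tendsto_of_tendsto_of_tendsto_of_le_of_le tendsto_const_nhds hz
      (fun _ => zero_le) hbd
    have := tendsto_integral_of_L1' (f := fun _ => (0 : ℝ)) (μ := volume.restrict (cell L))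
      aestronglyMeasurable_const (.of_forall i1) (l := atTop)
      (by simpa [Pi.sub_def] using hL1)
    simpa using this
  simp only [hsplit]
  simpa using h1.add h2

/-- `∫ u ∂ᵢ∂ᵢu = -∫ (∂ᵢu)²`, for weak derivatives `p = ∂ᵢu` and `q = ∂ᵢp`. -/
lemma IsWeakPartial.integral_mul_second (hL : ∀ i, 0 < L i) {p q : (Fin d → ℝ) → ℝ} {i : Fin d}
    (hu : MemL2 L u) (hp : MemL2 L p) (hq : MemL2 L q) (hup : IsWeakPartial L i u p)
    (hpq : IsWeakPartial L i p q) :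
    ∫ x in cell L, u x * q x = -∫ x in cell L, p x ^ 2 := by
  obtain ⟨F, hF, -⟩ := hu.exists_seq_fourierSum_tendsto hL
  have hone : ∀ᵐ x ∂volume.restrict (cell L),
      Tendsto (fun _ : ℕ => (1 : ℝ)) atTop (𝓝 ((fun _ => (1 : ℝ)) x)) :=
    .of_forall fun _ => tendsto_const_nhds
  have h1 := tendsto_integral_mul_mul (h := fun _ _ => 1) (C := 1)
    (fun n => aestronglyMeasurable_const) (fun n x => by simp) hone
    (fun n => (isTest_fourierSum hL (F n) p).memLp 2) hp hp ((tendsto_fourierSum hL hp).comp hF)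
  have h2 := tendsto_integral_mul_mul (h := fun _ _ => 1) (C := 1)
    (fun n => aestronglyMeasurable_const) (fun n x => by simp) hone
    (fun n => (isTest_fourierSum hL (F n) u).memLp 2) hu hq
    ((tendsto_fourierSum hL hu).comp hF)
  have heq : ∀ n, ∫ x in cell L, p x * fourierSum L (F n) p x
      = -∫ x in cell L, q x * fourierSum L (F n) u x := by
    intro n
    rw [← hpq _ (isTest_fourierSum hL (F n) u), ← hup.pderiv_fourierSum hL (F n)]
    rfl
  simp only [one_mul] at h1 h2
  simp only [heq] at h1
  have h3 := tendsto_nhds_unique h1 h2.neg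
  simp only [mul_comm (u _), pow_two, h3, neg_neg]

/-- `∫ u³ ∂ᵢ∂ᵢu = -3 ∫ u² (∂ᵢu)²`, for weak derivatives `p = ∂ᵢu` and `q = ∂ᵢp`: the cubes of the
partial Fourier sums of `u` are admissible test functions, and these sums are uniformly bounded. -/
lemma IsWeakPartial.integral_pow_three_mul_second (hL : ∀ i, 0 < L i) {p q : (Fin d → ℝ) → ℝ}
    {i : Fin d} (hu : MemL2 L u) (hp : MemL2 L p) (hq : MemL2 L q) (hup : IsWeakPartial L i u p)
    (hpq : IsWeakPartial L i p q) {M : ℝ} (hM : ∀ F x, |fourierSum L F u x| ≤ M) :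
    ∫ x in cell L, u x ^ 3 * q x = -(3 * ∫ x in cell L, u x ^ 2 * p x ^ 2) := by
  obtain ⟨F, hF, hFae⟩ := hu.exists_seq_fourierSum_tendsto hL
  have hm : ∀ n, AEStronglyMeasurable (fun x => fourierSum L (F n) u x ^ 2)
      (volume.restrict (cell L)) := fun n =>
    ((isTest_fourierSum hL (F n) u).pow 2).continuous.aestronglyMeasurable
  have hbd : ∀ n x, |fourierSum L (F n) u x ^ 2| ≤ M ^ 2 := fun n x => by
    rw [abs_pow]
    exact pow_le_pow_left₀ (abs_nonneg _) (hM _ _) 2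
  have hlim : ∀ᵐ x ∂volume.restrict (cell L),
      Tendsto (fun n => fourierSum L (F n) u x ^ 2) atTop (𝓝 ((fun x => u x ^ 2) x)) := by
    filter_upwards [hFae] with x hx using hx.pow 2
  have h1 := tendsto_integral_mul_mul hm hbd hlim
    (fun n => (isTest_fourierSum hL (F n) p).memLp 2) hp hp ((tendsto_fourierSum hL hp).comp hF)
  have h2 := tendsto_integral_mul_mul hm hbd hlim
    (fun n => (isTest_fourierSum hL (F n) u).memLp 2) hu hq
    ((tendsto_fourierSum hL hu).comp hF)
  have heq : ∀ n, 3 * ∫ x in cell L, fourierSum L (F n) u x ^ 2 * (p x * fourierSum L (F n) p x)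
      = -∫ x in cell L, fourierSum L (F n) u x ^ 2 * (q x * fourierSum L (F n) u x) := by
    intro n
    have ht := isTest_fourierSum hL (F n) u
    have h := hpq _ (ht.pow 3)
    have e1 : ∀ x, q x * fourierSum L (F n) u x ^ 3
        = fourierSum L (F n) u x ^ 2 * (q x * fourierSum L (F n) u x) := fun x => by ring
    have e2 : ∀ x, p x * fderiv ℝ (fun y => fourierSum L (F n) u y ^ 3) x (Pi.single i 1)
        = 3 * (fourierSum L (F n) u x ^ 2 * (p x * fourierSum L (F n) p x)) := fun x => by
      have := pderiv_pow ht 3 i x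
      rw [hup.pderiv_fourierSum hL, pderiv] at this
      rw [this]
      push_cast
      ring
    simp only [e1, e2, integral_const_mul] at h
    exact h
  have h3 := h1.const_mul 3
  simp only [heq] at h3
  have h4 := tendsto_nhds_unique h3 h2.neg
  have e3 : ∀ x, u x ^ 3 * q x = u x ^ 2 * (q x * u x) := fun x => by ring
  simp only [e3, pow_two (p _)]
  linarith

/-- `‖Δu‖² = ∑ᵢⱼ ‖∂ⱼ∂ᵢu‖²`, by Parseval's identity. -/
lemma MemH2.integral_lap_sq (hL : ∀ i, 0 < L i) (hu : MemH2 L u) :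
    ∫ x in cell L, lap L u x ^ 2
      = ∑ i, ∑ j, ∫ x in cell L, weakPartial L j (weakPartial L i u) x ^ 2 := by
  have hcoef : ∀ (g : (Fin d → ℝ) → ℝ), IsTest L g → ∫ x in cell L, lap L u x * g x
      = ∑ i, ∫ x in cell L, weakPartial L i (weakPartial L i u) x * g x := by
    intro g hg
    rw [← integral_finsetSum _ fun i _ =>
      ((hu.partial_memH1 i).memL2_weakPartial i).integrable_mul (hg.memLp 2)]
    refine integral_congr_ae (.of_forall fun x => ?_)
    simp only [lap, Finset.sum_mul]
  have hcos : ∀ k, cosCoeff L (lap L u) k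
      = -((∑ i, (2 * Real.pi * k i / L i) ^ 2) * cosCoeff L u k) := by
    intro k
    have : cosCoeff L (lap L u) k
        = ∑ i, cosCoeff L (weakPartial L i (weakPartial L i u)) k := by
      rw [cosCoeff, hcoef _ (isTest_cos_phase hL k), Finset.mul_sum]
      rfl
    simp only [this, hu.coeff_weakPartial_weakPartial hL, Finset.sum_neg_distrib, Finset.sum_mul,
      pow_two]
  have hsin : ∀ k, sinCoeff L (lap L u) k
      = -((∑ i, (2 * Real.pi * k i / L i) ^ 2) * sinCoeff L u k) := by
    intro k
    have : sinCoeff L (lap L u) k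
        = ∑ i, sinCoeff L (weakPartial L i (weakPartial L i u)) k := by
      rw [sinCoeff, hcoef _ (isTest_sin_phase hL k), Finset.mul_sum]
      rfl
    simp only [this, hu.coeff_weakPartial_weakPartial hL, Finset.sum_neg_distrib, Finset.sum_mul,
      pow_two]
  have h1 := hasSum_sq_coeff hL hu.memL2_lap
  have h2 := hasSum_sum (s := Finset.univ) fun i _ => hasSum_sum (s := Finset.univ) fun j _ =>
    hasSum_sq_coeff hL ((hu.partial_memH1 i).memL2_weakPartial j)
  have h3 : ∀ k, cosCoeff L (lap L u) k ^ 2 + sinCoeff L (lap L u) k ^ 2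
      = ∑ i, ∑ j, (cosCoeff L (weakPartial L j (weakPartial L i u)) k ^ 2
        + sinCoeff L (weakPartial L j (weakPartial L i u)) k ^ 2) := by
    intro k
    simp only [hcos, hsin, hu.coeff_weakPartial_weakPartial hL]
    have : ∀ i j : Fin d,
        (-(2 * Real.pi * k i / L i * (2 * Real.pi * k j / L j) * cosCoeff L u k)) ^ 2
        + (-(2 * Real.pi * k i / L i * (2 * Real.pi * k j / L j) * sinCoeff L u k)) ^ 2
        = (2 * Real.pi * k i / L i) ^ 2 * (2 * Real.pi * k j / L j) ^ 2
          * (cosCoeff L u k ^ 2 + sinCoeff L u k ^ 2) := fun i j => by ring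
    simp only [this, ← Finset.sum_mul, ← Finset.mul_sum]
    ring
  simp only [h3] at h1
  have h4 := h1.unique h2
  simp only [← Finset.mul_sum] at h4
  exact mul_left_cancel₀ (inv_ne_zero (Finset.prod_ne_zero_iff.2 fun i _ => (hL i).ne')) h4

end IntegralIdentities

/-! ### Integrability of products -/

section Integrability

variable {d : ℕ} {L : Fin d → ℝ} {u w : (Fin d → ℝ) → ℝ}

lemma MemH2.memLp_top_pow (hd : d ≤ 3) (hL : ∀ i, 0 < L i) (hu : MemH2 L u) (n : ℕ) :
    MemLp (fun x => u x ^ n) ⊤ (volume.restrict (cell L)) := by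
  induction n with
  | zero => simpa using memLp_const (1 : ℝ)
  | succ n ih =>
    simp only [pow_succ]
    exact (hu.memLp_top hd hL).mul ih

lemma holderTriple_four_four_two : ENNReal.HolderTriple 4 4 2 := ⟨by
  have h : (4 : ℝ≥0∞) = 2 * 2 := by norm_num
  rw [h, ENNReal.mul_inv (by simp) (by simp), ← mul_add, ENNReal.inv_two_add_inv_two, mul_one]⟩

/-- Products of first derivatives of `H²` functions are in `L²`. -/
lemma MemH2.memL2_gradDot (hd : d ≤ 3) (hL : ∀ i, 0 < L i) (hu : MemH2 L u) (hw : MemH2 L w) :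
    MemL2 L (gradDot L u w) := by
  have := holderTriple_four_four_two
  unfold MemL2 gradDot
  exact memLp_finsetSum _ fun i _ =>
    (hw.memLp_weakPartial_four hd hL i).mul (hu.memLp_weakPartial_four hd hL i)

lemma memL2_of_memLp_top (hu : MemLp u ⊤ (volume.restrict (cell L))) : MemL2 L u :=
  hu.mono_exponent le_top

lemma memL2_mul (hu : MemLp u ⊤ (volume.restrict (cell L))) (hw : MemL2 L w) :
    MemL2 L (fun x => u x * w x) :=
  MemLp.mul (p := ⊤) (q := 2) hw hu

end Integrability

/-! ### The expanded energy and its coercivity -/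

section Energy

variable {d : ℕ} {L : Fin d → ℝ} {u w : (Fin d → ℝ) → ℝ}

/-- The integrand of the expanded energy, with `t`, `G`, `l` in the place of `u`, `|∇u|²`, `Δu`. -/
def energyDensity (ε η t G l : ℝ) : ℝ :=
  (ε ^ 2)⁻¹ / 2 * t ^ 6 - ((ε ^ 2)⁻¹ + η / 4) * t ^ 4 + ((ε ^ 2)⁻¹ + η) / 2 * t ^ 2
    - (1 + η * ε ^ 2 / 2) * G + ε ^ 2 / 2 * l ^ 2 + 3 * (t ^ 2 * G)

lemma MemH2.integrable_pow (hd : d ≤ 3) (hL : ∀ i, 0 < L i) (hu : MemH2 L u) (n : ℕ) :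
    Integrable (fun x => u x ^ n) (volume.restrict (cell L)) :=
  (memL2_of_memLp_top (hu.memLp_top_pow hd hL n)).integrable

lemma MemH2.integrable_pow_mul (hd : d ≤ 3) (hL : ∀ i, 0 < L i) (hu : MemH2 L u)
    {g : (Fin d → ℝ) → ℝ} (hg : MemL2 L g) (n : ℕ) :
    Integrable (fun x => u x ^ n * g x) (volume.restrict (cell L)) :=
  (memL2_mul (hu.memLp_top_pow hd hL n) hg).integrable

lemma MemH2.memL2_gradSq (hd : d ≤ 3) (hL : ∀ i, 0 < L i) (hu : MemH2 L u) :
    MemL2 L (gradSq L u) := hu.memL2_gradDot hd hL hu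

/-- `∫ u Δu = -∫ |∇u|²`. -/
lemma MemH2.integral_mul_lap (hL : ∀ i, 0 < L i) (hu : MemH2 L u) :
    ∫ x in cell L, u x * lap L u x = -∫ x in cell L, gradSq L u x := by
  have h2 : ∀ i, Integrable (fun x => weakPartial L i u x * weakPartial L i u x)
      (volume.restrict (cell L)) := fun i =>
    (hu.memH1.memL2_weakPartial i).integrable_mul (hu.memH1.memL2_weakPartial i)
  simp only [lap, gradSq, gradDot, Finset.mul_sum]
  rw [integral_finsetSum _ fun i _ => hu.memH1.memL2.integrable_mul
      ((hu.partial_memH1 i).memL2_weakPartial i), integral_finsetSum _ fun i _ => h2 i,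
    ← Finset.sum_neg_distrib]
  refine Finset.sum_congr rfl fun i _ => ?_
  simp only [← pow_two]
  exact (hu.memH1.isWeakPartial i).integral_mul_second hL hu.memH1.memL2
    (hu.memH1.memL2_weakPartial i) ((hu.partial_memH1 i).memL2_weakPartial i)
    ((hu.partial_memH1 i).isWeakPartial i)

/-- `∫ u³ Δu = -3 ∫ u² |∇u|²`. -/
lemma MemH2.integral_pow_three_mul_lap (hd : d ≤ 3) (hL : ∀ i, 0 < L i) (hu : MemH2 L u) :
    ∫ x in cell L, u x ^ 3 * lap L u x = -(3 * ∫ x in cell L, u x ^ 2 * gradSq L u x) := by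
  obtain ⟨M, hM⟩ := hu.exists_abs_fourierSum_le hd hL
  have hself : ENNReal.HolderTriple 4 4 2 := holderTriple_four_four_two
  have h2 : ∀ i, MemL2 L (fun x => weakPartial L i u x * weakPartial L i u x) := fun i =>
    (hu.memLp_weakPartial_four hd hL i).mul (hu.memLp_weakPartial_four hd hL i)
  simp only [lap, gradSq, gradDot, Finset.mul_sum]
  rw [integral_finsetSum _ fun i _ => hu.integrable_pow_mul hd hL
      ((hu.partial_memH1 i).memL2_weakPartial i) 3,
    integral_finsetSum _ fun i _ => hu.integrable_pow_mul hd hL (h2 i) 2, Finset.mul_sum,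
    ← Finset.sum_neg_distrib]
  refine Finset.sum_congr rfl fun i _ => ?_
  simp only [← pow_two]
  exact (hu.memH1.isWeakPartial i).integral_pow_three_mul_second hL hu.memH1.memL2
    (hu.memH1.memL2_weakPartial i) ((hu.partial_memH1 i).memL2_weakPartial i)
    ((hu.partial_memH1 i).isWeakPartial i) hM

lemma MemH2.integrable_energyDensity (hd : d ≤ 3) (hL : ∀ i, 0 < L i) (hu : MemH2 L u)
    (ε η : ℝ) :
    Integrable (fun x => energyDensity ε η (u x) (gradSq L u x) (lap L u x))
      (volume.restrict (cell L)) := by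
  have hG := hu.memL2_gradSq hd hL
  unfold energyDensity
  exact (((((hu.integrable_pow hd hL 6).const_mul _).sub
    ((hu.integrable_pow hd hL 4).const_mul _)).add ((hu.integrable_pow hd hL 2).const_mul _)).sub
    (hG.integrable.const_mul _)).add (hu.memL2_lap.integrable_sq.const_mul _) |>.add
    ((hu.integrable_pow_mul hd hL hG 2).const_mul _)

/-- The energy, expanded by means of the two integrations by parts `∫ u Δu = -∫ |∇u|²` and
`∫ u³ Δu = -3 ∫ u² |∇u|²`. -/
theorem MemH2.energy_eq (hd : d ≤ 3) (hL : ∀ i, 0 < L i) (hu : MemH2 L u)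
    {ε : ℝ} (hε : 0 < ε) (η : ℝ) :
    energy L ε η u
      = ∫ x in cell L, energyDensity ε η (u x) (gradSq L u x) (lap L u x) := by
  have hG := hu.memL2_gradSq hd hL
  have hl := hu.memL2_lap
  have h1 := hu.integral_mul_lap hL
  have h2 := hu.integral_pow_three_mul_lap hd hL
  have i1 : Integrable (fun x => chemCH L ε u x ^ 2) (volume.restrict (cell L)) := by
    have hu3 := memL2_of_memLp_top (hu.memLp_top_pow hd hL 3)
    have : MemL2 L (chemCH L ε u) :=
      (MemLp.sub hu3 hu.memH1.memL2).sub (MemLp.const_mul hl (ε ^ 2))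
    exact this.integrable_sq
  have i2 : Integrable (fun x => 1 / 4 * u x ^ 4 - 1 / 2 * u x ^ 2 + ε ^ 2 / 2 * gradSq L u x)
      (volume.restrict (cell L)) :=
    (((hu.integrable_pow hd hL 4).const_mul _).sub ((hu.integrable_pow hd hL 2).const_mul _)).add
      (hG.integrable.const_mul _)
  have i3 : Integrable (fun x => u x * lap L u x) (volume.restrict (cell L)) :=
    hu.memH1.memL2.integrable_mul hl
  have i4 := hu.integrable_pow_mul hd hL hl 3
  have i5 := hu.integrable_pow_mul hd hL hG 2
  have hpt : ∀ x, energyDensity ε η (u x) (gradSq L u x) (lap L u x)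
      = ((ε ^ 2)⁻¹ / 2 * chemCH L ε u x ^ 2
        - η * (1 / 4 * u x ^ 4 - 1 / 2 * u x ^ 2 + ε ^ 2 / 2 * gradSq L u x))
        + ((u x ^ 3 * lap L u x + 3 * (u x ^ 2 * gradSq L u x))
          - (u x * lap L u x + gradSq L u x)) := by
    intro x
    unfold energyDensity chemCH
    field_simp
    ring
  simp only [hpt]
  rw [integral_add ((i1.const_mul _).sub' (i2.const_mul _))
      ((i4.fun_add (i5.const_mul 3)).sub' (i3.fun_add hG.integrable)),
    integral_sub (i1.const_mul _) (i2.const_mul _),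
    integral_sub (i4.fun_add (i5.const_mul 3)) (i3.fun_add hG.integrable),
    integral_add i4 (i5.const_mul 3), integral_add i3 hG.integrable, integral_const_mul,
    integral_const_mul, integral_const_mul, h1, h2, energy, energyCH]
  ring

lemma MemH2.normH2_sq (hL : ∀ i, 0 < L i) (hu : MemH2 L u) :
    normH2 L u ^ 2 = (∫ x in cell L, u x ^ 2)
    - (∫ x in cell L, u x * lap L u x) + ∫ x in cell L, lap L u x ^ 2 := by
  have h2 : ∀ i, Integrable (fun x => weakPartial L i u x * weakPartial L i u x)
      (volume.restrict (cell L)) := fun i =>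
    (hu.memH1.memL2_weakPartial i).integrable_mul (hu.memH1.memL2_weakPartial i)
  rw [normH2, Real.sq_sqrt, hu.integral_lap_sq hL, hu.integral_mul_lap hL, sub_neg_eq_add]
  · simp only [gradSq, gradDot]
    rw [integral_finsetSum _ fun i _ => h2 i]
    simp only [pow_two]
  · positivity

/-- The term `(1 + ηε²/2)(tl + G)` has integral zero for `t = u`, `l = Δu`, `G = |∇u|²`; it trades
`|∇u|²` for `-u Δu`. Young's inequality then leaves a polynomial in `t` with positive leading term
`(ε⁻²/3) t⁶`, which is bounded below. -/
lemma exists_le_energyDensity {ε : ℝ} (hε : 0 < ε) (η : ℝ) : ∃ K, 0 ≤ K ∧ ∀ t l G : ℝ, 0 ≤ G →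
    (ε ^ 2)⁻¹ / 6 * t ^ 6 + 1 / 4 * ε ^ 2 * (t ^ 2 - t * l + l ^ 2)
      ≤ energyDensity ε η t G l + (1 + η * ε ^ 2 / 2) * (t * l + G) + K := by
  set e := (ε ^ 2)⁻¹ with he
  have he0 : 0 < e := by positivity
  set β := 1 + η * ε ^ 2 / 2 + ε ^ 2 / 4 with hβ
  set b := |e + η / 4| with hb
  set c := |(e + η) / 2 - ε ^ 2 / 4 - β ^ 2 * e| with hc
  have hb0 : 0 ≤ b := abs_nonneg _
  have hc0 : 0 ≤ c := abs_nonneg _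
  set T := 3 * (b + c) / e + 1 with hT
  have hT1 : 1 ≤ T := by rw [hT]; linarith [show 0 ≤ 3 * (b + c) / e by positivity]
  refine ⟨b * T ^ 2 + c * T, by positivity, fun t l G hG => ?_⟩
  have hcub : ∀ s : ℝ, 0 ≤ s → b * s ^ 2 + c * s ≤ e / 3 * s ^ 3 + (b * T ^ 2 + c * T) := by
    intro s hs
    rcases le_total s T with h | h
    · have : 0 ≤ e / 3 * s ^ 3 := by positivity
      have h1 : b * s ^ 2 ≤ b * T ^ 2 := by gcongr
      have h2 : c * s ≤ c * T := by gcongr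
      linarith
    · have hs1 : 1 ≤ s := hT1.trans h
      have h1 : (b + c) * s ^ 2 ≤ e / 3 * s ^ 3 := by
        have : b + c ≤ e / 3 * s := by
          have h3 : 3 * (b + c) / e ≤ s := by linarith
          rw [div_le_iff₀ he0] at h3
          linarith
        calc (b + c) * s ^ 2 ≤ (e / 3 * s) * s ^ 2 := by gcongr
          _ = e / 3 * s ^ 3 := by ring
      have h2 : c * s ≤ c * s ^ 2 := by
        have : s ≤ s ^ 2 := by nlinarith
        gcongr
      have : 0 ≤ b * T ^ 2 + c * T := by positivity
      linarith
  have h1 := hcub (t ^ 2) (sq_nonneg t)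
  have h2 : (e + η / 4) * t ^ 4 ≤ b * t ^ 4 :=
    mul_le_mul_of_nonneg_right (le_abs_self _) (by positivity)
  have h3 : -(c * t ^ 2) ≤ ((e + η) / 2 - ε ^ 2 / 4 - β ^ 2 * e) * t ^ 2 := by
    rw [← neg_mul]
    exact mul_le_mul_of_nonneg_right (neg_abs_le _) (sq_nonneg t)
  have h4 : 0 ≤ ε ^ 2 / 4 * l ^ 2 + β * (t * l) + β ^ 2 * e * t ^ 2 := by
    have : ε ^ 2 / 4 * l ^ 2 + β * (t * l) + β ^ 2 * e * t ^ 2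
        = e * (ε ^ 2 / 2 * l + β * t) ^ 2 := by
      rw [he]
      field_simp
      ring
    rw [this]
    positivity
  have h5 : 0 ≤ t ^ 2 * G := by positivity
  have h6 : energyDensity ε η t G l + (1 + η * ε ^ 2 / 2) * (t * l + G)
      = e / 2 * t ^ 6 - (e + η / 4) * t ^ 4 + (e + η) / 2 * t ^ 2
        + (1 + η * ε ^ 2 / 2) * (t * l) + ε ^ 2 / 2 * l ^ 2 + 3 * (t ^ 2 * G) := by
    rw [energyDensity, ← he]
    ring
  rw [h6]
  have h7 : β * (t * l) = (1 + η * ε ^ 2 / 2) * (t * l) + ε ^ 2 / 4 * (t * l) := by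
    rw [hβ]; ring
  have h8 : (t ^ 2) ^ 2 = t ^ 4 := by ring
  have h9 : (t ^ 2) ^ 3 = t ^ 6 := by ring
  rw [h8, h9] at h1
  linarith

lemma gradSq_nonneg (L : Fin d → ℝ) (u : (Fin d → ℝ) → ℝ) (x : Fin d → ℝ) : 0 ≤ gradSq L u x := by
  unfold gradSq gradDot
  exact Finset.sum_nonneg fun i _ => mul_self_nonneg _

/-- Coercivity of the energy. -/
theorem exists_energy_lower_bound (hd : d ≤ 3) (hL : ∀ i, 0 < L i) {ε : ℝ} (hε : 0 < ε) (η : ℝ) :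
    ∃ C, 0 ≤ C ∧ ∀ u, MemH2 L u →
      (ε ^ 2)⁻¹ / 6 * (∫ x in cell L, u x ^ 6) + 1 / 4 * ε ^ 2 * normH2 L u ^ 2
        ≤ energy L ε η u + C := by
  obtain ⟨K, hK, h⟩ := exists_le_energyDensity hε η
  refine ⟨∫ _ in cell L, K, integral_nonneg fun _ => hK, fun u hu => ?_⟩
  have hG := (hu.memL2_gradSq hd hL).integrable
  have i1 := hu.integrable_pow hd hL 6
  have i2 := hu.integrable_pow hd hL 2
  have i3 : Integrable (fun x => u x * lap L u x) (volume.restrict (cell L)) :=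
    hu.memH1.memL2.integrable_mul hu.memL2_lap
  have i4 : Integrable (fun x => lap L u x ^ 2) (volume.restrict (cell L)) :=
    hu.memL2_lap.integrable_sq
  have i5 := hu.integrable_energyDensity hd hL ε η
  have i6 : Integrable (fun _ : Fin d → ℝ => K) (volume.restrict (cell L)) := integrable_const K
  have key := integral_mono ((i1.const_mul ((ε ^ 2)⁻¹ / 6)).fun_add
      (((i2.sub' i3).fun_add i4).const_mul (1 / 4 * ε ^ 2)))
    ((i5.fun_add ((i3.fun_add hG).const_mul (1 + η * ε ^ 2 / 2))).fun_add i6)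
    (fun x => h (u x) (lap L u x) (gradSq L u x) (gradSq_nonneg L u x))
  rw [integral_add (i1.const_mul _) (((i2.sub' i3).fun_add i4).const_mul _), integral_const_mul,
    integral_const_mul, integral_add (i2.sub' i3) i4, integral_sub i2 i3,
    integral_add (i5.fun_add ((i3.fun_add hG).const_mul _)) i6,
    integral_add i5 ((i3.fun_add hG).const_mul _),
    integral_const_mul, integral_add i3 hG, hu.integral_mul_lap hL] at key
  rw [hu.normH2_sq hL, hu.energy_eq hd hL hε, hu.integral_mul_lap hL]
  linarith

end Energy

/-! ### Pointwise convexity -/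

/-- The tangent-plane inequality for the convex function `a⁴ + |p|⁴ + 3a²|p|²`, at `(a, p)` and
`(b, q)`, in terms of `P = |p|²`, `Q = |q|²` and `R = p · q`. With `h = b - a` and `k = q - p` the
remainder is the integral over `0 ≤ s ≤ 1` of `1 - s` times the Hessian form at `(a + sh, p + sk)`,
which is nonnegative: up to squares it is `4(|p|²|k|² - (p · k)²)`. -/
lemma tangent_quartic {a b P Q R : ℝ} (hK : 0 ≤ P + Q - 2 * R)
    (hN : 0 ≤ 4 * P + 4 * R + Q) (hR : R ^ 2 ≤ P * Q) :
    (a ^ 4 + P ^ 2 + 3 * (a ^ 2 * P)) - (b ^ 4 + Q ^ 2 + 3 * (b ^ 2 * Q))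
      ≤ 4 * a ^ 3 * (a - b) + 6 * (a * P * (a - b)) + 6 * (a ^ 2 * (P - R))
        + 4 * (P * (P - R)) := by
  obtain ⟨h, rfl⟩ : ∃ h, b = a + h := ⟨b - a, by ring⟩
  set K := P + Q - 2 * R with hKdef
  set S := R - P with hS
  have h1 : 0 ≤ 12 * ((a * h + S + (h ^ 2 + K) / 3) ^ 2 / 2 + (h ^ 2 + K) ^ 2 / 36)
      + 6 * (h ^ 2 * ((4 * P + 4 * R + Q) / 9 / 2 + K / 36)
        + K * ((a + h / 3) ^ 2 / 2 + h ^ 2 / 36)) + 2 * (P * Q - R ^ 2) := by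
    have : 0 ≤ P * Q - R ^ 2 := by linarith
    positivity
  have h2 : 4 * a ^ 3 * (a - (a + h)) + 6 * (a * P * (a - (a + h))) + 6 * (a ^ 2 * (P - R))
        + 4 * (P * (P - R))
      - ((a ^ 4 + P ^ 2 + 3 * (a ^ 2 * P)) - ((a + h) ^ 4 + Q ^ 2 + 3 * ((a + h) ^ 2 * Q)))
      = 12 * ((a * h + S + (h ^ 2 + K) / 3) ^ 2 / 2 + (h ^ 2 + K) ^ 2 / 36)
      + 6 * (h ^ 2 * ((4 * P + 4 * R + Q) / 9 / 2 + K / 36)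
        + K * ((a + h / 3) ^ 2 / 2 + h ^ 2 / 36)) + 2 * (P * Q - R ^ 2) := by
    rw [hKdef, hS]
    ring
  linarith

/-- `a⁴ - b⁴ ≤ 4a³(a - b)`. -/
lemma pow_four_sub_le (a b : ℝ) : a ^ 4 - b ^ 4 ≤ 4 * a ^ 3 * (a - b) := by
  have : 4 * a ^ 3 * (a - b) - (a ^ 4 - b ^ 4) = (a - b) ^ 2 * ((a + b) ^ 2 + 2 * a ^ 2) := by ring
  have h : 0 ≤ (a - b) ^ 2 * ((a + b) ^ 2 + 2 * a ^ 2) := by positivity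
  linarith

/-- `a⁶ - b⁶ ≤ 6a⁵(a - b)`. -/
lemma pow_six_sub_le (a b : ℝ) : a ^ 6 - b ^ 6 ≤ 6 * a ^ 5 * (a - b) := by
  have : 6 * a ^ 5 * (a - b) - (a ^ 6 - b ^ 6)
      = (a - b) ^ 2 * (2 * a ^ 4 + (b ^ 2 + a * b) ^ 2 + 2 * a ^ 2 * (a + b) ^ 2 + a ^ 4) := by ring
  have h : 0 ≤ (a - b) ^ 2
      * (2 * a ^ 4 + (b ^ 2 + a * b) ^ 2 + 2 * a ^ 2 * (a + b) ^ 2 + a ^ 4) := by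
    positivity
  linarith

/-- The pointwise form of the convex splitting inequality
`F(w) - F(u) ≤ ⟨δF_c(w), w - u⟩ - ⟨δF_e(u), w - u⟩`, with `a`, `P`, `l` for `w`, `|∇w|²`, `Δw`, with
`b`, `Q`, `m` for the same quantities of `u`, and with `R = ∇w · ∇u`. -/
lemma energyDensity_sub_le {ε η A a b P Q R l m : ℝ} (hη : -(ε ^ 2)⁻¹ ≤ η)
    (hε : 0 < ε) (hA : 1 ≤ A) (hP : 0 ≤ P) (hQ : 0 ≤ Q) (hK : 0 ≤ P + Q - 2 * R)
    (hN : 0 ≤ 4 * P + 4 * R + Q) (hR : R ^ 2 ≤ P * Q) :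
    energyDensity ε η a P l - energyDensity ε η b Q m
      ≤ (((3 * (ε ^ 2)⁻¹ * a ^ 5 + 4 * A * a ^ 3 + ((ε ^ 2)⁻¹ + η) * a) * (a - b)
          + ε ^ 2 * (l * (l - m)) + 6 * (a * P * (a - b)) + 6 * (a ^ 2 * (P - R))
          + 4 * A * (P * (P - R))))
        - (((4 * (ε ^ 2)⁻¹ + η) * b ^ 3 + 4 * A * b ^ 3) * (a - b)
          + (2 + η * ε ^ 2) * (R - Q) + 4 * A * (Q * (R - Q))) := by
  have hη2 : -1 ≤ η * ε ^ 2 := by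
    have := mul_le_mul_of_nonneg_right hη (sq_nonneg ε)
    rwa [neg_mul, inv_mul_cancel₀ (by positivity)] at this
  unfold energyDensity
  set e := (ε ^ 2)⁻¹
  have he : 0 < e := by positivity
  have h1 := mul_le_mul_of_nonneg_left (pow_six_sub_le a b) (show 0 ≤ e / 2 by positivity)
  have h2 := mul_nonneg (show 0 ≤ (e + η) / 2 by linarith) (sq_nonneg (a - b))
  have h3 := mul_nonneg (show 0 ≤ ε ^ 2 / 2 by positivity) (sq_nonneg (l - m))
  have h4 := tangent_quartic (a := a) (b := b) hK hN hR
  have h5 := mul_le_mul_of_nonneg_left (pow_four_sub_le a b) (show 0 ≤ A - 1 by linarith)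
  have hPQ : P ^ 2 - Q ^ 2 ≤ 4 * (P * (P - R)) := by nlinarith [mul_nonneg hP hK, sq_nonneg (P - Q)]
  have hQP : Q ^ 2 - P ^ 2 ≤ 4 * (Q * (Q - R)) := by nlinarith [mul_nonneg hQ hK, sq_nonneg (P - Q)]
  have h6 := mul_le_mul_of_nonneg_left hPQ (show 0 ≤ A - 1 by linarith)
  have h7 := mul_le_mul_of_nonneg_left (pow_four_sub_le b a)
    (show 0 ≤ e + η / 4 + A by linarith)
  have h8 := mul_nonneg (show 0 ≤ 1 + η * ε ^ 2 / 2 by linarith) hK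
  have h9 := mul_le_mul_of_nonneg_left hQP (show 0 ≤ A by linarith)
  linarith

/-! ### Energy stability of the scheme -/

section EnergyDecay

variable {d : ℕ} {L : Fin d → ℝ} {u v w : (Fin d → ℝ) → ℝ}

lemma MemH1.gradDot_sub (hL : ∀ i, 0 < L i) (hu : MemH1 L u) (hw : MemH1 L w)
    (v : (Fin d → ℝ) → ℝ) : gradDot L v (w - u)
      =ᵐ[volume.restrict (cell L)] fun x => gradDot L v w x - gradDot L v u x := by
  filter_upwards [ae_all_iff.2 fun i => hw.weakPartial_sub hL hu i] with x hx
  simp only [gradDot, hx, Pi.sub_apply, mul_sub, Finset.sum_sub_distrib]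

lemma gradDot_comm (L : Fin d → ℝ) (u w : (Fin d → ℝ) → ℝ) (x : Fin d → ℝ) :
    gradDot L u w x = gradDot L w u x := by
  simp only [gradDot, mul_comm]

lemma gradDot_sq_le (L : Fin d → ℝ) (u w : (Fin d → ℝ) → ℝ) (x : Fin d → ℝ) :
    gradDot L w u x ^ 2 ≤ gradSq L w x * gradSq L u x := by
  simp only [gradSq, gradDot, ← pow_two]
  exact Finset.sum_mul_sq_le_sq_mul_sq _ _ _

/-- `|α∇w + β∇u|² ≥ 0`. -/
lemma gradSq_combination_nonneg (L : Fin d → ℝ) (u w : (Fin d → ℝ) → ℝ) (x : Fin d → ℝ)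
    (α β : ℝ) :
    0 ≤ α ^ 2 * gradSq L w x + 2 * α * β * gradDot L w u x + β ^ 2 * gradSq L u x := by
  simp only [gradSq, gradDot, Finset.mul_sum, ← Finset.sum_add_distrib]
  refine Finset.sum_nonneg fun i _ => ?_
  nlinarith [sq_nonneg (α * weakPartial L i w x + β * weakPartial L i u x)]

/-- The convex splitting inequality: if `⟨δF_c(w) - δF_e(u), w - u⟩ ≤ 0`, the step from `u` to `w`
does not increase the energy. -/
theorem MemH2.energy_le_of_var_le (hd : d ≤ 3) (hL : ∀ i, 0 < L i) (hu : MemH2 L u)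
    (hw : MemH2 L w) {ε η A : ℝ} (hε : 0 < ε) (hη : -(ε ^ 2)⁻¹ ≤ η) (hA : 1 ≤ A)
    (h : varFc L ε η A w (w - u) - varFe L ε η A u (w - u) ≤ 0) :
    energy L ε η w ≤ energy L ε η u := by
  have hP := hw.memL2_gradSq hd hL
  have hQ := hu.memL2_gradSq hd hL
  have hR := hw.memL2_gradDot hd hL hu
  have hPR := hP.sub hR
  have hRQ := hR.sub hQ
  have hwu := hw.memH1.memL2.sub hu.memH1.memL2
  have hlm := hw.memL2_lap.sub hu.memL2_lap
  have ht1 : MemL2 L (fun x => 3 * (ε ^ 2)⁻¹ * w x ^ 5 + 4 * A * w x ^ 3 + ((ε ^ 2)⁻¹ + η) * w x) :=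
    (((memL2_of_memLp_top (hw.memLp_top_pow hd hL 5)).const_mul _).add
      ((memL2_of_memLp_top (hw.memLp_top_pow hd hL 3)).const_mul _)).add
      (hw.memH1.memL2.const_mul _)
  have hs1 : MemL2 L (fun x => (4 * (ε ^ 2)⁻¹ + η) * u x ^ 3 + 4 * A * u x ^ 3) :=
    ((memL2_of_memLp_top (hu.memLp_top_pow hd hL 3)).const_mul _).add
      ((memL2_of_memLp_top (hu.memLp_top_pow hd hL 3)).const_mul _)
  have T1 := ht1.integrable_mul hwu
  have T2 := hw.memL2_lap.integrable_mul hlm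
  have T3 := (memL2_mul (hw.memLp_top hd hL) hP).integrable_mul hwu
  have T4 := hw.integrable_pow_mul hd hL hPR 2
  have T5 := hP.integrable_mul hPR
  have S1 := hs1.integrable_mul hwu
  have S2 : Integrable (fun x => gradDot L w u x - gradSq L u x) (volume.restrict (cell L)) :=
    hRQ.integrable
  have S3 := hQ.integrable_mul hRQ
  have eP := hu.memH1.gradDot_sub hL hw.memH1 w
  have eQ := hu.memH1.gradDot_sub hL hw.memH1 u
  have el := hw.lap_sub hL hu
  have e2 : ip L (lap L w) (lap L (w - u))
      = ∫ x in cell L, lap L w x * (lap L w - lap L u) x :=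
    integral_congr_ae (by filter_upwards [el] with x hx; rw [hx])
  have e4 : ∫ x in cell L, w x ^ 2 * gradDot L w (w - u) x
      = ∫ x in cell L, w x ^ 2 * (gradSq L w - gradDot L w u) x :=
    integral_congr_ae (by filter_upwards [eP] with x hx; rw [hx]; rfl)
  have e5 : ∫ x in cell L, gradSq L w x * gradDot L w (w - u) x
      = ∫ x in cell L, gradSq L w x * (gradSq L w - gradDot L w u) x :=
    integral_congr_ae (by filter_upwards [eP] with x hx; rw [hx]; rfl)
  have f2 : ∫ x in cell L, gradDot L u (w - u) x
      = ∫ x in cell L, (gradDot L w u x - gradSq L u x) :=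
    integral_congr_ae (by filter_upwards [eQ] with x hx; rw [hx, gradDot_comm L u w]; rfl)
  have f3 : ∫ x in cell L, gradSq L u x * gradDot L u (w - u) x
      = ∫ x in cell L, gradSq L u x * (gradDot L w u - gradSq L u) x :=
    integral_congr_ae (by filter_upwards [eQ] with x hx; rw [hx, gradDot_comm L u w]; rfl)
  have J1 := ((((T1.fun_add (T2.const_mul (ε ^ 2))).fun_add (T3.const_mul 6)).fun_add
    (T4.const_mul 6)).fun_add (T5.const_mul (4 * A)))
  have J2 := (S1.fun_add (S2.const_mul (2 + η * ε ^ 2))).fun_add (S3.const_mul (4 * A))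
  have key := integral_mono ((hw.integrable_energyDensity hd hL ε η).sub'
    (hu.integrable_energyDensity hd hL ε η)) (J1.sub' J2) fun x => by
      have hPRQ := gradSq_combination_nonneg L u w x 1 (-1)
      have hN := gradSq_combination_nonneg L u w x 2 1
      refine (energyDensity_sub_le hη hε hA (gradSq_nonneg L w x) (gradSq_nonneg L u x)
        (R := gradDot L w u x) (by linarith) (by linarith) (gradDot_sq_le L u w x)).trans ?_
      simp only [Pi.sub_apply]
      exact le_rfl
  rw [integral_sub (hw.integrable_energyDensity hd hL ε η) (hu.integrable_energyDensity hd hL ε η),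
    ← hw.energy_eq hd hL hε, ← hu.energy_eq hd hL hε, integral_sub J1 J2,
    integral_add (((T1.fun_add (T2.const_mul _)).fun_add (T3.const_mul _)).fun_add (T4.const_mul _))
      (T5.const_mul _),
    integral_add ((T1.fun_add (T2.const_mul _)).fun_add (T3.const_mul _)) (T4.const_mul _),
    integral_add (T1.fun_add (T2.const_mul _)) (T3.const_mul _),
    integral_add T1 (T2.const_mul _), integral_add (S1.fun_add (S2.const_mul _)) (S3.const_mul _),
    integral_add S1 (S2.const_mul _)] at key
  simp only [integral_const_mul] at key
  simp only [varFc, varFe, e2, e4, e5, f2, f3] at h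
  simp only [ip] at h
  linarith

/-- The scheme is unconditionally energy stable: test the first equation with the chemical potential
and the second one with `w - u`. -/
theorem IsStep.energy_le (hd : d ≤ 3) (hL : ∀ i, 0 < L i) {ε η A s : ℝ} (hε : 0 < ε)
    (hη : -(ε ^ 2)⁻¹ ≤ η) (hA : 1 ≤ A) (hs : 0 < s) (hu : MemH2 L u)
    (h : IsStep L ε η A s u w) : energy L ε η w ≤ energy L ε η u := by
  obtain ⟨hw, μ, hμ, h1, h2⟩ := h
  refine hu.energy_le_of_var_le hd hL hw hε hη hA ?_
  have h3 := h2 (w - u) (hw.sub hL hu)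
  have h4 := h1 μ hμ
  have h5 : ip L μ (w - u) = ip L w μ - ip L u μ := by
    unfold ip
    rw [← integral_sub (hw.memH1.memL2.integrable_mul hμ.memL2)
      (hu.memH1.memL2.integrable_mul hμ.memL2)]
    refine integral_congr_ae (.of_forall fun x => ?_)
    simp only [Pi.sub_apply]
    ring
  have h6 : 0 ≤ ∫ x in cell L, gradDot L μ μ x := integral_nonneg (gradSq_nonneg L μ)
  have h7 : 0 ≤ s * ∫ x in cell L, gradDot L μ μ x := by positivity
  linarith

lemma IsSchemeSolution.memH2_and_energy_le (hd : d ≤ 3) (hL : ∀ i, 0 < L i) {ε η A s : ℝ}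
    (hε : 0 < ε) (hη : -(ε ^ 2)⁻¹ ≤ η) (hA : 1 ≤ A) (hs : 0 < s) {φ₀ : (Fin d → ℝ) → ℝ}
    {φ : ℕ → (Fin d → ℝ) → ℝ} (h₀ : MemH2 L φ₀) (h : IsSchemeSolution L ε η A s φ₀ φ) (k : ℕ) :
    MemH2 L (φ k) ∧ energy L ε η (φ k) ≤ energy L ε η (φ 0) := by
  induction k with
  | zero => exact ⟨h.init ▸ h₀, le_rfl⟩
  | succ k ih => exact ⟨(h.step k).memH2, ((h.step k).energy_le hd hL hε hη hA hs ih.1).trans ih.2⟩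

end EnergyDecay

end

end FCH

theorem mainTheorem6 (d : ℕ) (hd : d = 2 ∨ d = 3) (L : Fin d → ℝ) (hL : ∀ i, 0 < L i) :
    ∃ C₀ : ℝ, 0 < C₀ ∧ ∀ ε η : ℝ, 0 < ε → -(ε ^ 2)⁻¹ ≤ η →
      ∃ C₁ : ℝ, 0 < C₁ ∧
        (∀ u : (Fin d → ℝ) → ℝ, FCH.MemH2 L u →
          (ε ^ 2)⁻¹ / 6 * (∫ x in FCH.cell L, u x ^ 6) + C₀ * ε ^ 2 * FCH.normH2 L u ^ 2
            ≤ FCH.energy L ε η u + C₁) ∧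
        ∀ A s : ℝ, 1 ≤ A → 0 < s →
          ∀ (φ₀ : (Fin d → ℝ) → ℝ) (φ : ℕ → (Fin d → ℝ) → ℝ),
            FCH.MemH2 L φ₀ → FCH.IsSchemeSolution L ε η A s φ₀ φ →
            ∀ k : ℕ, 0 < k →
              FCH.normH2 L (φ k) ≤ (FCH.energy L ε η (φ 0) + C₁) / (C₀ * ε ^ 2) ∧
              FCH.normH2 L (φ k) ^ 2 ≤ (FCH.energy L ε η (φ 0) + C₁) / (C₀ * ε ^ 2) := by
  have hd3 : d ≤ 3 := by omega
  refine ⟨1 / 4, by norm_num, fun ε η hε hη => ?_⟩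
  obtain ⟨C, hC, hbound⟩ := FCH.exists_energy_lower_bound hd3 hL hε η
  have hε2 : 0 < 1 / 4 * ε ^ 2 := by positivity
  -- The extra `ε²/4` makes the bound at least `1`, so that it also controls the unsquared norm.
  refine ⟨C + 1 / 4 * ε ^ 2, by positivity, fun u hu => (hbound u hu).trans (by linarith), ?_⟩
  intro A s hA hs φ₀ φ h₀ hφ k _
  obtain ⟨hk, hle⟩ := hφ.memH2_and_energy_le hd3 hL hε hη hA hs h₀ k
  have h6 : 0 ≤ (ε ^ 2)⁻¹ / 6 * ∫ x in FCH.cell L, φ k x ^ 6 :=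
    mul_nonneg (by positivity) (MeasureTheory.integral_nonneg fun x => by positivity)
  have hb := hbound _ hk
  have hmain : FCH.normH2 L (φ k) ^ 2 + 1
      ≤ (FCH.energy L ε η (φ 0) + (C + 1 / 4 * ε ^ 2)) / (1 / 4 * ε ^ 2) := by
    rw [le_div_iff₀ hε2]
    linarith
  refine ⟨?_, by linarith⟩
  nlinarith [sq_nonneg (FCH.normH2 L (φ k) - 1 / 2)]
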